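/- Let $0<\alpha<\pi$, $\rho>0$, and let $S=\{(r\cos\theta,r\sin\theta):0<r<\rho,\ |\theta|<\alpha/2\}$ (near its corner at the origin, the inclusion $D$ satisfies $D\cap B_\rho=S$). Put $$A=\frac{\alpha}{2\pi-\alpha},\qquad k_+=-\frac{2\pi-\alpha}{\alpha},\qquad k_-=-\frac{\alpha}{2\pi-\alpha},\qquad \lambda_+=-\lambda_-=\frac12\Bigl(1-\frac{\alpha}{\pi}\Bigr).$$ Let $H^1_\Gamma(S)$ be the space of all $\phi\in H^1(S)$ whose trace vanishes on the arc $r=\rho$, with the $H^1$ norm, and let $H^{-1}(S)$ denote its dual (the data are paired with test functions that vanish on the arc but not necessarily on the edges $\theta=\pm\alpha/2$). Let $H^1_0(S)$ be the subspace of $H^1_\Gamma(S)$ of functions whose trace also vanishes on the two edges, and let $$V_1=\{(w,v)\in H^1_\Gamma(S)\times H^1_\Gamma(S):\ v(r,\pm\alpha/2)=w(r,\pm\alpha/2)\ \text{for } 0<r<\rho\}$$ in the sense of traces. For $a>0$ put $$b_a(u,\phi)=\int_S\Bigl(\partial_ru\,\partial_r\phi+\frac{a^2}{r^2}\,\partial_\theta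 u\,\partial_\theta\phi\Bigr)\,dx .$$ (a) For real $k\ne1$, with $\lambda=\frac{k+1}{2(k-1)}$, one has $k\notin[k_+,k_-]$ if and only if $\lambda\notin[\lambda_-,\lambda_+]$. (b) Let $k$ be real with $k\notin[k_+,k_-]$. There is a constant $C>0$, which does not depend on the data, such that for all $f,g\in H^{-1}(S)$ the system $$\partial_{rr}^2w+\tfrac1r\partial_rw+\tfrac1{r^2}\partial_{\theta\theta}^2w=f,\qquad \partial_{rr}^2v+\tfrac1r\partial_rv+\tfrac{A^2}{r^2}\partial_{\theta\theta}^2v=g\qquad\text{in }S,$$ $$v=w=0\ \text{ for } r=\rho,\qquad v=w\ \text{ and }\ \partial_\theta v=-\frac kA\,\partial_\theta w\ \text{ for }\theta=\pm\alpha/2,$$ has a unique solution $(w,v)\in V_1$, and $$\|\nabla w\|_{L^2(S)}+\|\nabla v\|_{L^2(S)}\le C\bigl(\|f\|_{H^{-1}(S)}+\|g\|_{H^{-1}(S)}\bigr).$$ The system is understood weakly. The two equations mean $-b_1(w,\phi)=\langle f,\phi\rangle$ and $-b_A(v,\phi)=\langle g,\phi\rangle$ for all $\phi\in H^1_0(S)$.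 The angular derivatives on the edges are defined by Green's formula, so that the last edge condition means $$\frac1{A^2}\bigl(\langle g,\chi\rangle+b_A(v,\chi)\bigr)=-\frac kA\bigl(\langle f,\chi\rangle+b_1(w,\chi)\bigr)\qquad\text{for all }\chi\in H^1_\Gamma(S).$$ -/

import Mathlib

open MeasureTheory Filter Set
open scoped Topology ContDiff

/-- The Euclidean plane. -/
abbrev Plane : Type := EuclideanSpace ℝ (Fin 2)

/-- The point with polar coordinates `(r, θ)`. -/
noncomputable def polarPt (r θ : ℝ) : Plane := !₂[r * Real.cos θ, r * Real.sin θ]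

/-- The open sector of radius `ρ` and opening angle `α`, symmetric about the first axis
(near a corner at the origin this is the part of the inclusion in the ball of radius `ρ`). -/
def sector (α ρ : ℝ) : Set Plane :=
  {x | ∃ r θ : ℝ, 0 < r ∧ r < ρ ∧ |θ| < α / 2 ∧ x = polarPt r θ}

/-! ### The Sobolev space `H¹(S)` -/

/-- Pairs (function, vector field) of class `L²` on `S`, with the Hilbert norm
`(‖u‖² + ‖G‖²)^(1/2)`. -/
abbrev L2Pair (S : Set Plane) : Type :=
  WithLp 2 (Lp ℝ 2 (volume.restrict S) × Lp Plane 2 (volume.restrict S))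

/-- `G` is the weak (distributional) gradient of `u` on `S`. -/
def IsWeakGradient (S : Set Plane) (u : Plane → ℝ) (G : Plane → Plane) : Prop :=
  ∀ φ : Plane → ℝ, ContDiff ℝ ∞ φ → HasCompactSupport φ → tsupport φ ⊆ S → ∀ e : Plane,
    ∫ x in S, u x * fderiv ℝ φ x e = -∫ x in S, inner ℝ e (G x) * φ x

theorem integrable_mul_of_test {S : Set Plane} {u φ : Plane → ℝ}
    (hu : MemLp u 2 (volume.restrict S)) (hφ : Continuous φ) (hc : HasCompactSupport φ) :
    Integrable (fun x => u x * φ x) (volume.restrict S) :=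
  MemLp.integrable_mul (p := 2) (q := 2) hu (hφ.memLp_of_hasCompactSupport hc)

/-- The Sobolev space `H¹(S)`: a function in `L²(S)` together with its weak gradient in
`L²(S; ℝ²)` (which the function determines), with the usual `H¹` norm. -/
noncomputable def H1 (S : Set Plane) : Submodule ℝ (L2Pair S) where
  carrier := {p | IsWeakGradient S p.fst p.snd}
  zero_mem' := by
    intro φ hφ hc hs e
    have h1 : ∫ x in S, (((0 : L2Pair S).fst : Plane → ℝ) x) * fderiv ℝ φ x e = 0 := by
      refine integral_eq_zero_of_ae ?_
      filter_upwards [Lp.coeFn_zero ℝ 2 (volume.restrict S)] with x hx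
      have hx' : ((0 : L2Pair S).fst : Plane → ℝ) x = 0 := hx
      simp only [hx', zero_mul, Pi.zero_apply]
    have h2 : ∫ x in S, inner ℝ e (((0 : L2Pair S).snd : Plane → Plane) x) * φ x = 0 := by
      refine integral_eq_zero_of_ae ?_
      filter_upwards [Lp.coeFn_zero Plane 2 (volume.restrict S)] with x hx
      have hx' : ((0 : L2Pair S).snd : Plane → Plane) x = 0 := hx
      simp only [hx', inner_zero_right, zero_mul, Pi.zero_apply]
    rw [h1, h2, neg_zero]
  add_mem' := by
    intro p q hp hq φ hφ hc hs e
    have hd : Continuous fun x => fderiv ℝ φ x e :=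
      (hφ.continuous_fderiv (by simp)).clm_apply continuous_const
    have hdc : HasCompactSupport fun x => fderiv ℝ φ x e := hc.fderiv_apply ℝ e
    have h1 : ∫ x in S, (((p + q : L2Pair S).fst : Plane → ℝ) x) * fderiv ℝ φ x e
        = (∫ x in S, (p.fst : Plane → ℝ) x * fderiv ℝ φ x e)
          + ∫ x in S, (q.fst : Plane → ℝ) x * fderiv ℝ φ x e := by
      rw [← integral_add (integrable_mul_of_test (Lp.memLp p.fst) hd hdc)
        (integrable_mul_of_test (Lp.memLp q.fst) hd hdc)]
      refine integral_congr_ae ?_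
      filter_upwards [Lp.coeFn_add p.fst q.fst] with x hx
      have hx' : ((p + q : L2Pair S).fst : Plane → ℝ) x
          = (p.fst : Plane → ℝ) x + (q.fst : Plane → ℝ) x := hx
      simp only [hx', add_mul]
    have h2 : ∫ x in S, inner ℝ e (((p + q : L2Pair S).snd : Plane → Plane) x) * φ x
        = (∫ x in S, inner ℝ e ((p.snd : Plane → Plane) x) * φ x)
          + ∫ x in S, inner ℝ e ((q.snd : Plane → Plane) x) * φ x := by
      rw [← integral_add
        (integrable_mul_of_test ((Lp.memLp p.snd).const_inner e) hφ.continuous hc)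
        (integrable_mul_of_test ((Lp.memLp q.snd).const_inner e) hφ.continuous hc)]
      refine integral_congr_ae ?_
      filter_upwards [Lp.coeFn_add p.snd q.snd] with x hx
      have hx' : ((p + q : L2Pair S).snd : Plane → Plane) x
          = (p.snd : Plane → Plane) x + (q.snd : Plane → Plane) x := hx
      simp only [hx', inner_add_right, add_mul]
    rw [h1, h2, hp φ hφ hc hs e, hq φ hφ hc hs e]
    ring
  smul_mem' := by
    intro c p hp φ hφ hc hs e
    have h1 : ∫ x in S, (((c • p : L2Pair S).fst : Plane → ℝ) x) * fderiv ℝ φ x e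
        = c * ∫ x in S, (p.fst : Plane → ℝ) x * fderiv ℝ φ x e := by
      rw [← integral_const_mul]
      refine integral_congr_ae ?_
      filter_upwards [Lp.coeFn_smul c p.fst] with x hx
      have hx' : ((c • p : L2Pair S).fst : Plane → ℝ) x = c * (p.fst : Plane → ℝ) x := hx
      simp only [hx', mul_assoc]
    have h2 : ∫ x in S, inner ℝ e (((c • p : L2Pair S).snd : Plane → Plane) x) * φ x
        = c * ∫ x in S, inner ℝ e ((p.snd : Plane → Plane) x) * φ x := by
      rw [← integral_const_mul]
      refine integral_congr_ae ?_
      filter_upwards [Lp.coeFn_smul c p.snd] with x hx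
      have hx' : ((c • p : L2Pair S).snd : Plane → Plane) x = c • (p.snd : Plane → Plane) x := hx
      simp only [hx', inner_smul_right, mul_assoc]
    rw [h1, h2, hp φ hφ hc hs e]
    ring

/-- The function underlying an element of `H¹(S)`. -/
noncomputable def h1fn {S : Set Plane} (u : H1 S) : Lp ℝ 2 (volume.restrict S) :=
  (u : L2Pair S).fst

/-- The weak gradient of an element of `H¹(S)`; its norm is the `L²(S)` norm of the gradient. -/
noncomputable def h1grad {S : Set Plane} (u : H1 S) : Lp Plane 2 (volume.restrict S) :=
  (u : L2Pair S).snd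

/-! ### Traces -/

/-- `t` is the trace of `u ∈ H¹(S)` along the boundary curve `γ : I → ∂S`: some functions that
are smooth up to the boundary converge to `u` in `H¹(S)`, and their restrictions to the curve
converge to `t` in `L²(I)`. -/
def HasTrace {S : Set Plane} (γ : ℝ → Plane) (I : Set ℝ) (u : H1 S) (t : ℝ → ℝ) : Prop :=
  MemLp t 2 (volume.restrict I) ∧
  ∃ φ : ℕ → Plane → ℝ, (∀ n, ContDiff ℝ ∞ (φ n)) ∧
    Tendsto (fun n => eLpNorm (fun x => φ n x - (h1fn u) x) 2 (volume.restrict S)) atTop (𝓝 0) ∧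
    Tendsto (fun n => eLpNorm (fun x => gradient (φ n) x - (h1grad u) x) 2 (volume.restrict S))
      atTop (𝓝 0) ∧
    Tendsto (fun n => eLpNorm (fun s => φ n (γ s) - t s) 2 (volume.restrict I)) atTop (𝓝 0)

/-- `u(ρ, θ) = 0` for `|θ| < α/2`, in the sense of traces. -/
def VanishesOnArc {α ρ : ℝ} (u : H1 (sector α ρ)) : Prop :=
  HasTrace (fun θ => polarPt ρ θ) (Ioo (-(α / 2)) (α / 2)) u 0

/-- `u(r, ±α/2) = 0` for `0 < r < ρ`, in the sense of traces. -/
def VanishesOnEdges {α ρ : ℝ} (u : H1 (sector α ρ)) : Prop :=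
  HasTrace (fun r => polarPt r (α / 2)) (Ioo 0 ρ) u 0 ∧
  HasTrace (fun r => polarPt r (-(α / 2))) (Ioo 0 ρ) u 0

/-- The space of all `φ ∈ H¹` of the sector that vanish on the arc `r = ρ`. -/
noncomputable def H1Arc (α ρ : ℝ) : Submodule ℝ (H1 (sector α ρ)) where
  carrier := {u | VanishesOnArc u}
  zero_mem' := by
    refine ⟨MemLp.zero, fun _ _ => 0, fun _ => contDiff_const, ?_, ?_, ?_⟩
    · refine tendsto_const_nhds.congr' (Eventually.of_forall fun n => ?_)
      symm
      rw [← eLpNorm_zero (ε := ℝ) (p := 2) (μ := volume.restrict (sector α ρ))]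
      refine eLpNorm_congr_ae ?_
      filter_upwards [Lp.coeFn_zero ℝ 2 (volume.restrict (sector α ρ))] with x hx
      have hx' : (h1fn (0 : H1 (sector α ρ)) : Plane → ℝ) x = 0 := hx
      simp [hx']
    · refine tendsto_const_nhds.congr' (Eventually.of_forall fun n => ?_)
      symm
      rw [← eLpNorm_zero (ε := Plane) (p := 2) (μ := volume.restrict (sector α ρ))]
      refine eLpNorm_congr_ae ?_
      filter_upwards [Lp.coeFn_zero Plane 2 (volume.restrict (sector α ρ))] with x hx
      have hx' : (h1grad (0 : H1 (sector α ρ)) : Plane → Plane) x = 0 := hx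
      simp [hx', gradient]
    · simp
  add_mem' := by
    rintro u v ⟨-, φ, hφ, h1, h2, h3⟩ ⟨-, ψ, hψ, k1, k2, k3⟩
    refine ⟨MemLp.zero, fun n x => φ n x + ψ n x, fun n => (hφ n).add (hψ n), ?_, ?_, ?_⟩
    · refine tendsto_of_tendsto_of_tendsto_of_le_of_le tendsto_const_nhds
        (by simpa using h1.add k1) (fun _ => zero_le) fun n => ?_
      refine le_trans (le_of_eq (eLpNorm_congr_ae ?_)) (eLpNorm_add_le
        ((hφ n).continuous.aestronglyMeasurable.sub (Lp.aestronglyMeasurable _))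
        ((hψ n).continuous.aestronglyMeasurable.sub (Lp.aestronglyMeasurable _)) (by norm_num))
      filter_upwards [Lp.coeFn_add (h1fn u) (h1fn v)] with x hx
      have h0 : (h1fn (u + v) : Plane → ℝ) x = (h1fn u) x + (h1fn v) x := hx
      simp only [h0, Pi.add_apply]
      ring
    · have hg : ∀ (χ : Plane → ℝ), ContDiff ℝ ∞ χ → Continuous (gradient χ) := fun χ hχ =>
        (InnerProductSpace.toDual ℝ Plane).symm.continuous.comp
          (hχ.continuous_fderiv (by simp))
      refine tendsto_of_tendsto_of_tendsto_of_le_of_le tendsto_const_nhds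
        (by simpa using h2.add k2) (fun _ => zero_le) fun n => ?_
      refine le_trans (le_of_eq (eLpNorm_congr_ae ?_)) (eLpNorm_add_le
        ((hg _ (hφ n)).aestronglyMeasurable.sub (Lp.aestronglyMeasurable _))
        ((hg _ (hψ n)).aestronglyMeasurable.sub (Lp.aestronglyMeasurable _)) (by norm_num))
      filter_upwards [Lp.coeFn_add (h1grad u) (h1grad v)] with x hx
      have h0 : (h1grad (u + v) : Plane → Plane) x = (h1grad u) x + (h1grad v) x := hx
      have h' : gradient (fun x => φ n x + ψ n x) x = gradient (φ n) x + gradient (ψ n) x := by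
        simp only [gradient]
        rw [fderiv_fun_add ((hφ n).differentiable (by simp) x)
          ((hψ n).differentiable (by simp) x), map_add]
      simp only [h0, h', Pi.add_apply]
      abel
    · have hm : ∀ (χ : Plane → ℝ), ContDiff ℝ ∞ χ →
          Continuous (fun s => χ (polarPt ρ s)) := by
        intro χ hχ
        have : Continuous fun s => polarPt ρ s := by
          unfold polarPt
          fun_prop
        exact hχ.continuous.comp this
      refine tendsto_of_tendsto_of_tendsto_of_le_of_le tendsto_const_nhds
        (by simpa using h3.add k3) (fun _ => zero_le) fun n => ?_
      refine le_trans (le_of_eq (congrArg (fun F => eLpNorm F 2 _) ?_)) (eLpNorm_add_le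
        (hm _ (hφ n)).aestronglyMeasurable (hm _ (hψ n)).aestronglyMeasurable (by norm_num))
      ext s
      simp
  smul_mem' := by
    rintro c u ⟨-, φ, hφ, h1, h2, h3⟩
    have key : ∀ {a : ℕ → ENNReal}, Tendsto a atTop (𝓝 0) →
        Tendsto (fun n => ‖c‖ₑ * a n) atTop (𝓝 0) := fun h => by
      simpa using ENNReal.Tendsto.const_mul h (Or.inr (by simp))
    refine ⟨MemLp.zero, fun n x => c * φ n x, fun n => contDiff_const.mul (hφ n), ?_, ?_, ?_⟩
    · refine (key h1).congr fun n => ?_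
      rw [← eLpNorm_const_smul]
      refine eLpNorm_congr_ae ?_
      filter_upwards [Lp.coeFn_smul c (h1fn u)] with x hx
      have h0 : (h1fn (c • u) : Plane → ℝ) x = c * (h1fn u) x := hx
      simp [h0, mul_sub]
    · refine (key h2).congr fun n => ?_
      rw [← eLpNorm_const_smul]
      refine eLpNorm_congr_ae ?_
      filter_upwards [Lp.coeFn_smul c (h1grad u)] with x hx
      have h0 : (h1grad (c • u) : Plane → Plane) x = c • (h1grad u) x := hx
      have h' : gradient (fun x => c * φ n x) x = c • gradient (φ n) x := by
        simp only [gradient]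
        rw [fderiv_const_mul ((hφ n).differentiable (by simp) x)]
        simp
      simp [h0, h', smul_sub]
    · refine (key h3).congr fun n => ?_
      rw [← eLpNorm_const_smul]
      refine congrArg (fun F => eLpNorm F 2 _) ?_
      ext s
      simp

/-- The closed subspace of `H¹ × H¹` of all `(w, v)` with `v = w = 0` on the arc `r = ρ` and
`v = w` on the edges `θ = ±α/2`. -/
def V1 (α ρ : ℝ) : Set (H1 (sector α ρ) × H1 (sector α ρ)) :=
  {W | VanishesOnArc W.1 ∧ VanishesOnArc W.2 ∧ VanishesOnEdges (W.2 - W.1)}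

/-- The dual of the space of `H¹` functions vanishing on the arc (the data space). -/
abbrev HNeg1 (α ρ : ℝ) : Type := H1Arc α ρ →L[ℝ] ℝ

/-! ### The folded transmission system -/

/-- `∂_r u`, computed from the gradient `G` of `u`. -/
noncomputable def radialPart (G : Plane → Plane) (x : Plane) : ℝ :=
  (x 0 * G x 0 + x 1 * G x 1) / ‖x‖

/-- `(1/r) ∂_θ u`, computed from the gradient `G` of `u`. -/
noncomputable def angularPart (G : Plane → Plane) (x : Plane) : ℝ :=
  (x 0 * G x 1 - x 1 * G x 0) / ‖x‖

/-- `∫_S (∂_r u ∂_r φ + (a²/r²) ∂_θ u ∂_θ φ)`, the form of the operator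
`-(∂²_rr + (1/r) ∂_r + (a²/r²) ∂²_θθ)`. -/
noncomputable def polarForm {S : Set Plane} (a : ℝ) (u φ : H1 S) : ℝ :=
  ∫ x in S, (radialPart (h1grad u) x * radialPart (h1grad φ) x
    + a ^ 2 * (angularPart (h1grad u) x * angularPart (h1grad φ) x))

/-- `∂²_rr u + (1/r) ∂_r u + (a²/r²) ∂²_θθ u = ℓ` in the sector, in the weak sense: tested with
all `φ` in `H¹₀`, the `H¹` functions of zero trace on the arc and on the edges. -/
def SolvesPolar {α ρ : ℝ} (a : ℝ) (u : H1 (sector α ρ)) (ℓ : HNeg1 α ρ) : Prop :=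
  ∀ φ : H1Arc α ρ, VanishesOnEdges (φ : H1 (sector α ρ)) →
    -polarForm a u (φ : H1 (sector α ρ)) = ℓ φ

/-- The weak angular (conormal) derivative of a solution `u` of
`∂²_rr u + (1/r) ∂_r u + (a²/r²) ∂²_θθ u = ℓ` on the edges, given by Green's formula. For smooth
`u` and `ℓ = ∫ f ·` it is
`χ ↦ ∫₀^ρ (1/r) (∂_θ u χ)(r, α/2) dr - ∫₀^ρ (1/r) (∂_θ u χ)(r, -α/2) dr`. -/
noncomputable def edgeFlux {α ρ : ℝ} (a : ℝ) (u : H1 (sector α ρ)) (ℓ : HNeg1 α ρ)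
    (χ : H1Arc α ρ) : ℝ :=
  (ℓ χ + polarForm a u (χ : H1 (sector α ρ))) / a ^ 2

/-- `A = α / (2π - α)`. -/
noncomputable def foldRatio (α : ℝ) : ℝ := α / (2 * Real.pi - α)

/-- `k₊ = -(2π - α)/α`. -/
noncomputable def kPlus (α : ℝ) : ℝ := -(2 * Real.pi - α) / α

/-- `k₋ = -α/(2π - α)`. -/
noncomputable def kMinus (α : ℝ) : ℝ := -α / (2 * Real.pi - α)

/-- `λ₊ = (1 - α/π)/2`. -/
noncomputable def lamPlus (α : ℝ) : ℝ := 1 / 2 * (1 - α / Real.pi)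

/-- `λ₋ = -λ₊`. -/
noncomputable def lamMinus (α : ℝ) : ℝ := -lamPlus α

/-- `W = (w, v)` solves the folded transmission system with data `(f, g)`: it lies in `V1`
(Dirichlet condition on the arc, `v = w` on the edges), solves the equations
`∂²_rr w + (1/r) ∂_r w + (1/r²) ∂²_θθ w = f` and
`∂²_rr v + (1/r) ∂_r v + (A²/r²) ∂²_θθ v = g`, and satisfies
`∂_θ v = -(k/A) ∂_θ w` on the edges. -/
structure IsFoldedSolution (α ρ k : ℝ) (f g : HNeg1 α ρ)
    (W : H1 (sector α ρ) × H1 (sector α ρ)) : Prop where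
  mem_V1 : W ∈ V1 α ρ
  eq_w : SolvesPolar 1 W.1 f
  eq_v : SolvesPolar (foldRatio α) W.2 g
  flux : ∀ χ : H1Arc α ρ,
    edgeFlux (foldRatio α) W.2 g χ = -(k / foldRatio α) * edgeFlux 1 W.1 f χ

/-! ### The critical interval for the contrast -/

/-! Part (a) is a factorization. With s = 1 - α/π the condition on λ reads (k+1)² ≤ s²(k-1)², and
the difference of the two squares is a product of two linear factors in k whose roots are k₊ and k₋.

Part (b) is Lax–Milgram for a well-chosen form. Let X be the H¹ functions vanishing on the arc, Y
the closed subspace vanishing also on the edges, b = b_1 and a = b_A. Since 0 < A ≤ 1, A² b ≤ a ≤ b,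
and a Poincaré inequality along rays makes b coercive on X (`VanishesOnArc.norm_sq_le`). The edge
condition v = w says that d = w - v lies in Y. Multiplied by A, the flux condition is an identity
for A⁻¹ a(v,χ) + k b(w,χ) over all χ in X. Testing it with χ in Y shows that one of the two interior
equations follows from the other, so the system amounts to the flux identity on X plus one equation
on Y.

For negative k the flux form has competing signs; the freedom is in which interior equation to keep
and with which weight. If k > -A, adding k + 2A times the equation for w gives a form whose diagonal
is at least (A+k) b(w,w) + A b(d,d) (`isCoercive_formAbove`). If k < -1/A, reversing the sign and
adding a multiple of the equation for v gives at least (-k-1/A) b(w,w) + A b(d,d)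
(`isCoercive_formBelow`). As k₊ = -1/A and k₋ = -A, these two cases exhaust the complement of [k₊,
k₋]. -/

theorem notMem_Icc_kPlus_kMinus_iff {α k : ℝ} (hα : 0 < α) (hαπ : α < Real.pi) (hk : k ≠ 1) :
    k ∉ Icc (kPlus α) (kMinus α) ↔
      (k + 1) / (2 * (k - 1)) ∉ Icc (lamMinus α) (lamPlus α) := by
  have hπ := Real.pi_pos
  -- In terms of s all four endpoints are rational functions, and π drops out.
  obtain ⟨s, hs⟩ : ∃ s, s = 1 - α / Real.pi := ⟨_, rfl⟩
  have hs0 : 0 < s := by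
    rw [hs, sub_pos, div_lt_one hπ]
    exact hαπ
  have hs1 : s < 1 := by
    rw [hs]
    linarith [div_pos hα hπ]
  have hαs : α = (1 - s) * Real.pi := by
    rw [hs]
    field_simp
    ring
  have hp : kPlus α = -(1 + s) / (1 - s) := by
    have : 1 - s ≠ 0 := by linarith
    rw [kPlus, hαs]
    field_simp
    ring
  have hm : kMinus α = -(1 - s) / (1 + s) := by
    have : 1 + s ≠ 0 := by linarith
    rw [kMinus, hαs, show 2 * Real.pi - (1 - s) * Real.pi = (1 + s) * Real.pi by ring]
    field_simp
  have hl : lamPlus α = s / 2 := by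
    rw [lamPlus, ← hs]
    ring
  have h1s : 0 < 1 - s := by linarith
  have h1s' : 0 < 1 + s := by linarith
  rw [not_iff_not, lamMinus, hl, hp, hm, mem_Icc, mem_Icc, ← abs_le, div_le_iff₀ h1s,
    le_div_iff₀ h1s', abs_div, abs_mul, abs_two,
    div_le_div_iff₀ (by have := abs_pos.2 (sub_ne_zero.2 hk); positivity) two_pos]
  have hsq : |k + 1| * 2 ≤ s * (2 * |k - 1|) ↔ (k + 1) ^ 2 ≤ (s * (k - 1)) ^ 2 := by
    rw [sq_le_sq, abs_mul, abs_of_pos hs0]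
    constructor <;> intro h <;> linarith
  rw [hsq]
  constructor
  · rintro ⟨h1, h2⟩
    nlinarith [mul_nonneg (sub_nonneg.2 h1) (sub_nonneg.2 h2)]
  · intro h
    -- The factors are (k+1) ∓ s(k-1). If either endpoint inequality failed, both factors would have
    -- the same strict sign, because k₊ < k₋.
    have h3 : (k * (1 - s) + (1 + s)) * (k * (1 + s) + (1 - s)) ≤ 0 := by nlinarith
    constructor <;> by_contra! hc
    · have : k * (1 + s) + (1 - s) < 0 := by nlinarith
      nlinarith
    · have : 0 < k * (1 - s) + (1 + s) := by nlinarith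
      nlinarith

/-! ### Completeness of the Sobolev spaces -/

theorem continuous_gradient_of_contDiff {φ : Plane → ℝ} (hφ : ContDiff ℝ ∞ φ) :
    Continuous (gradient φ) :=
  (InnerProductSpace.toDual ℝ Plane).symm.continuous.comp (hφ.continuous_fderiv (by simp))

theorem continuous_setIntegral_mul {S : Set Plane} {ψ : Plane → ℝ}
    (hψ : MemLp ψ 2 (volume.restrict S)) :
    Continuous fun u : Lp ℝ 2 (volume.restrict S) => ∫ x in S, u x * ψ x := by
  have h : (fun u : Lp ℝ 2 (volume.restrict S) => ∫ x in S, u x * ψ x)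
      = fun u => inner ℝ (hψ.toLp ψ) u := by
    ext u
    rw [L2.inner_def]
    refine integral_congr_ae ?_
    filter_upwards [hψ.coeFn_toLp] with x hx
    simp [hx]
  rw [h]
  fun_prop

theorem continuous_setIntegral_inner_mul {S : Set Plane} {ψ : Plane → ℝ}
    (hψ : MemLp ψ 2 (volume.restrict S)) (e : Plane) :
    Continuous fun G : Lp Plane 2 (volume.restrict S) => ∫ x in S, inner ℝ e (G x) * ψ x := by
  have hm : MemLp (fun x => ψ x • e) 2 (volume.restrict S) :=
    hψ.of_le_mul (c := ‖e‖) (hψ.1.smul_const e)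
      (Eventually.of_forall fun x => by rw [norm_smul, mul_comm])
  have h : (fun G : Lp Plane 2 (volume.restrict S) => ∫ x in S, inner ℝ e (G x) * ψ x)
      = fun G => inner ℝ (hm.toLp _) G := by
    ext G
    rw [L2.inner_def]
    refine integral_congr_ae ?_
    filter_upwards [hm.coeFn_toLp] with x hx
    rw [hx, real_inner_smul_left, mul_comm]
  rw [h]
  fun_prop

/-- For each test function and direction, the weak gradient identity equates two continuous
functionals on L², so it cuts out a closed set. -/
theorem isClosed_H1 (S : Set Plane) : IsClosed (H1 S : Set (L2Pair S)) := by
  have h : (H1 S : Set (L2Pair S)) = {p | IsWeakGradient S p.fst p.snd} := rfl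
  rw [h]
  simp only [IsWeakGradient, ofPred_forall]
  refine isClosed_iInter fun φ => isClosed_iInter fun hφ => isClosed_iInter fun hc =>
    isClosed_iInter fun _ => isClosed_iInter fun e => isClosed_eq ?_ ?_
  · have hd : Continuous fun x => fderiv ℝ φ x e :=
      (hφ.continuous_fderiv (by simp)).clm_apply continuous_const
    exact (continuous_setIntegral_mul (hd.memLp_of_hasCompactSupport
      (hc.fderiv_apply ℝ e))).comp (WithLp.continuous_fst 2 _ _)
  · exact ((continuous_setIntegral_inner_mul (hφ.continuous.memLp_of_hasCompactSupport hc)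
      e).comp (WithLp.continuous_snd 2 _ _)).neg

instance completeSpace_H1 (S : Set Plane) : CompleteSpace (H1 S) :=
  (isClosed_H1 S).completeSpace_coe

theorem norm_sq_H1 {S : Set Plane} (u : H1 S) : ‖u‖ ^ 2 = ‖h1fn u‖ ^ 2 + ‖h1grad u‖ ^ 2 :=
  WithLp.prod_norm_sq_eq_of_L2 _

theorem norm_h1fn_le {S : Set Plane} (u : H1 S) : ‖h1fn u‖ ≤ ‖u‖ :=
  abs_le_of_sq_le_sq' (by nlinarith [norm_sq_H1 u, sq_nonneg ‖h1grad u‖]) (norm_nonneg _) |>.2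

theorem norm_h1grad_le {S : Set Plane} (u : H1 S) : ‖h1grad u‖ ≤ ‖u‖ :=
  abs_le_of_sq_le_sq' (by nlinarith [norm_sq_H1 u, sq_nonneg ‖h1fn u‖]) (norm_nonneg _) |>.2

/-! ### Functions of zero trace -/

/-- With one approximant per ε instead of a sequence, limits of zero-trace functions can be handled
without a diagonal sequence. -/
theorem hasTrace_zero_iff {S : Set Plane} {γ : ℝ → Plane} {I : Set ℝ} {u : H1 S} :
    HasTrace γ I u 0 ↔ ∀ ε : ENNReal, 0 < ε → ∃ φ : Plane → ℝ, ContDiff ℝ ∞ φ ∧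
      eLpNorm (fun x => φ x - (h1fn u) x) 2 (volume.restrict S) ≤ ε ∧
      eLpNorm (fun x => gradient φ x - (h1grad u) x) 2 (volume.restrict S) ≤ ε ∧
      eLpNorm (fun s => φ (γ s)) 2 (volume.restrict I) ≤ ε := by
  constructor
  · rintro ⟨-, φ, hφ, h1, h2, h3⟩ ε hε
    simp only [Pi.zero_apply, sub_zero] at h3
    obtain ⟨n, ⟨hn1, hn2⟩, hn3⟩ := (((h1.eventually_le_const hε).and
      (h2.eventually_le_const hε)).and (h3.eventually_le_const hε)).exists
    exact ⟨φ n, hφ n, hn1, hn2, hn3⟩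
  · intro h
    have hpos : ∀ n : ℕ, (0 : ENNReal) < (n : ENNReal)⁻¹ := fun n => by simp
    choose φ hφ h1 h2 h3 using fun n : ℕ => h _ (hpos n)
    have h0 := ENNReal.tendsto_inv_nat_nhds_zero
    refine ⟨MemLp.zero, φ, hφ, ?_, ?_, ?_⟩
    · exact tendsto_of_tendsto_of_tendsto_of_le_of_le tendsto_const_nhds h0 (fun _ => zero_le) h1
    · exact tendsto_of_tendsto_of_tendsto_of_le_of_le tendsto_const_nhds h0 (fun _ => zero_le) h2
    · refine tendsto_of_tendsto_of_tendsto_of_le_of_le tendsto_const_nhds h0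
        (fun _ => zero_le) fun n => ?_
      simpa only [Pi.zero_apply, sub_zero] using h3 n

/-- An approximant of a nearby zero-trace function also approximates the limit, and its boundary
values are already small. No trace inequality is needed. -/
theorem isClosed_hasTrace_zero {S : Set Plane} (γ : ℝ → Plane) (I : Set ℝ) :
    IsClosed {u : H1 S | HasTrace γ I u 0} := by
  refine isClosed_of_closure_subset fun u hu => hasTrace_zero_iff.2 fun ε hε => ?_
  obtain ⟨v, hv, huv⟩ := EMetric.mem_closure_iff.1 hu (ε / 2) (ENNReal.half_pos hε.ne')
  obtain ⟨φ, hφ, h1, h2, h3⟩ := hasTrace_zero_iff.1 hv (ε / 2) (ENNReal.half_pos hε.ne')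
  have huv' : ‖v - u‖ₑ ≤ ε / 2 := by rw [← edist_eq_enorm_sub, edist_comm]; exact huv.le
  refine ⟨φ, hφ, ?_, ?_, h3.trans ENNReal.half_le_self⟩
  · have hd : eLpNorm (⇑(h1fn v) - ⇑(h1fn u)) 2 (volume.restrict S) ≤ ε / 2 := by
      rw [← Lp.edist_def, edist_eq_enorm_sub]
      exact (enorm_le_iff_norm_le.2 (norm_h1fn_le (v - u))).trans huv'
    refine le_trans (le_of_eq (congrArg (fun F => eLpNorm F 2 _) ?_)) ((eLpNorm_add_le
      (hφ.continuous.aestronglyMeasurable.sub (Lp.aestronglyMeasurable _))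
      ((Lp.aestronglyMeasurable _).sub (Lp.aestronglyMeasurable _)) (by norm_num)).trans
      ((add_le_add h1 hd).trans_eq (ENNReal.add_halves ε)))
    ext x
    simp
  · have hd : eLpNorm (⇑(h1grad v) - ⇑(h1grad u)) 2 (volume.restrict S) ≤ ε / 2 := by
      rw [← Lp.edist_def, edist_eq_enorm_sub]
      exact (enorm_le_iff_norm_le.2 (norm_h1grad_le (v - u))).trans huv'
    refine le_trans (le_of_eq (congrArg (fun F => eLpNorm F 2 _) ?_)) ((eLpNorm_add_le
      ((continuous_gradient_of_contDiff hφ).aestronglyMeasurable.sub (Lp.aestronglyMeasurable _))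
      ((Lp.aestronglyMeasurable _).sub (Lp.aestronglyMeasurable _)) (by norm_num)).trans
      ((add_le_add h2 hd).trans_eq (ENNReal.add_halves ε)))
    funext x
    simp

theorem hasTrace_zero_zero {S : Set Plane} (γ : ℝ → Plane) (I : Set ℝ) :
    HasTrace γ I (0 : H1 S) 0 := by
  refine hasTrace_zero_iff.2 fun ε _ => ⟨fun _ => 0, contDiff_const, ?_, ?_, by simp⟩
  · refine le_of_eq_of_le ((eLpNorm_congr_ae ?_).trans eLpNorm_zero) zero_le
    filter_upwards [Lp.coeFn_zero ℝ 2 (volume.restrict S)] with x hx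
    have hx' : (h1fn (0 : H1 S) : Plane → ℝ) x = 0 := hx
    simp [hx']
  · refine le_of_eq_of_le ((eLpNorm_congr_ae ?_).trans eLpNorm_zero) zero_le
    filter_upwards [Lp.coeFn_zero Plane 2 (volume.restrict S)] with x hx
    have hx' : (h1grad (0 : H1 S) : Plane → Plane) x = 0 := hx
    simp [hx', gradient]

theorem HasTrace.zero_add_zero {S : Set Plane} {γ : ℝ → Plane} (hγ : Continuous γ) {I : Set ℝ}
    {u v : H1 S} (hu : HasTrace γ I u 0) (hv : HasTrace γ I v 0) : HasTrace γ I (u + v) 0 := by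
  refine hasTrace_zero_iff.2 fun ε hε => ?_
  obtain ⟨φ, hφ, h1, h2, h3⟩ := hasTrace_zero_iff.1 hu (ε / 2) (ENNReal.half_pos hε.ne')
  obtain ⟨ψ, hψ, k1, k2, k3⟩ := hasTrace_zero_iff.1 hv (ε / 2) (ENNReal.half_pos hε.ne')
  refine ⟨fun x => φ x + ψ x, hφ.add hψ, ?_, ?_, ?_⟩
  · refine le_trans ?_ ((add_le_add h1 k1).trans_eq (ENNReal.add_halves ε))
    refine le_trans (le_of_eq (eLpNorm_congr_ae ?_)) (eLpNorm_add_le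
      (hφ.continuous.aestronglyMeasurable.sub (Lp.aestronglyMeasurable _))
      (hψ.continuous.aestronglyMeasurable.sub (Lp.aestronglyMeasurable _)) (by norm_num))
    filter_upwards [Lp.coeFn_add (h1fn u) (h1fn v)] with x hx
    have h0 : (h1fn (u + v) : Plane → ℝ) x = (h1fn u) x + (h1fn v) x := hx
    simp only [h0, Pi.add_apply]
    ring
  · refine le_trans ?_ ((add_le_add h2 k2).trans_eq (ENNReal.add_halves ε))
    refine le_trans (le_of_eq (eLpNorm_congr_ae ?_)) (eLpNorm_add_le
      ((continuous_gradient_of_contDiff hφ).aestronglyMeasurable.sub (Lp.aestronglyMeasurable _))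
      ((continuous_gradient_of_contDiff hψ).aestronglyMeasurable.sub (Lp.aestronglyMeasurable _))
      (by norm_num))
    filter_upwards [Lp.coeFn_add (h1grad u) (h1grad v)] with x hx
    have h0 : (h1grad (u + v) : Plane → Plane) x = (h1grad u) x + (h1grad v) x := hx
    have h' : gradient (fun x => φ x + ψ x) x = gradient φ x + gradient ψ x := by
      simp only [gradient]
      rw [fderiv_fun_add (hφ.differentiable (by simp) x) (hψ.differentiable (by simp) x), map_add]
    simp only [h0, h', Pi.add_apply]
    abel
  · refine le_trans ?_ ((add_le_add h3 k3).trans_eq (ENNReal.add_halves ε))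
    exact eLpNorm_add_le (hφ.continuous.comp hγ).aestronglyMeasurable
      (hψ.continuous.comp hγ).aestronglyMeasurable (by norm_num)

theorem HasTrace.const_smul_zero {S : Set Plane} {γ : ℝ → Plane} {I : Set ℝ}
    {u : H1 S} (hu : HasTrace γ I u 0) (c : ℝ) : HasTrace γ I (c • u) 0 := by
  obtain ⟨-, φ, hφ, h1, h2, h3⟩ := hu
  have key : ∀ {a : ℕ → ENNReal}, Tendsto a atTop (𝓝 0) →
      Tendsto (fun n => ‖c‖ₑ * a n) atTop (𝓝 0) := fun h => by
    simpa using ENNReal.Tendsto.const_mul h (Or.inr (by simp))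
  refine ⟨MemLp.zero, fun n x => c * φ n x, fun n => contDiff_const.mul (hφ n), ?_, ?_, ?_⟩
  · refine (key h1).congr fun n => ?_
    rw [← eLpNorm_const_smul]
    refine eLpNorm_congr_ae ?_
    filter_upwards [Lp.coeFn_smul c (h1fn u)] with x hx
    have h0 : (h1fn (c • u) : Plane → ℝ) x = c * (h1fn u) x := hx
    simp [h0, mul_sub]
  · refine (key h2).congr fun n => ?_
    rw [← eLpNorm_const_smul]
    refine eLpNorm_congr_ae ?_
    filter_upwards [Lp.coeFn_smul c (h1grad u)] with x hx
    have h0 : (h1grad (c • u) : Plane → Plane) x = c • (h1grad u) x := hx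
    have h' : gradient (fun x => c * φ n x) x = c • gradient (φ n) x := by
      simp only [gradient]
      rw [fderiv_const_mul ((hφ n).differentiable (by simp) x)]
      simp
    simp [h0, h', smul_sub]
  · refine (key h3).congr fun n => ?_
    rw [← eLpNorm_const_smul]
    refine congrArg (fun F => eLpNorm F 2 _) ?_
    ext s
    simp

theorem continuous_polarPt : Continuous fun p : ℝ × ℝ => polarPt p.1 p.2 := by
  unfold polarPt
  fun_prop

/-- The subspace `H¹₀` of functions vanishing on the arc and on the edges. -/
noncomputable def H1Zero (α ρ : ℝ) : Submodule ℝ (H1Arc α ρ) where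
  carrier := {u | VanishesOnEdges (u : H1 (sector α ρ))}
  zero_mem' := ⟨hasTrace_zero_zero _ _, hasTrace_zero_zero _ _⟩
  add_mem' hu hv :=
    ⟨hu.1.zero_add_zero (continuous_polarPt.comp (.prodMk_left _)) hv.1,
      hu.2.zero_add_zero (continuous_polarPt.comp (.prodMk_left _)) hv.2⟩
  smul_mem' c _ hu := ⟨hu.1.const_smul_zero c, hu.2.const_smul_zero c⟩

theorem isClosed_H1Arc (α ρ : ℝ) : IsClosed (H1Arc α ρ : Set (H1 (sector α ρ))) :=
  isClosed_hasTrace_zero _ _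

theorem isClosed_H1Zero (α ρ : ℝ) : IsClosed (H1Zero α ρ : Set (H1Arc α ρ)) :=
  ((isClosed_hasTrace_zero _ _).inter (isClosed_hasTrace_zero _ _)).preimage continuous_subtype_val

instance completeSpace_H1Arc (α ρ : ℝ) : CompleteSpace (H1Arc α ρ) :=
  (isClosed_H1Arc α ρ).completeSpace_coe

/-! ### Polar coordinates on the sector -/

theorem sector_eq_image {α ρ : ℝ} :
    sector α ρ = (fun p : ℝ × ℝ => (!₂[p.1, p.2] : Plane)) ''
      (polarCoord.symm '' (Ioo 0 ρ ×ˢ Ioo (-(α / 2)) (α / 2))) := by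
  ext x
  simp only [sector, mem_image, mem_prod, mem_Ioo, ← abs_lt, Prod.exists, polarCoord_symm_apply]
  constructor
  · rintro ⟨r, θ, h0, h1, h2, rfl⟩
    exact ⟨_, _, ⟨r, θ, ⟨⟨h0, h1⟩, h2⟩, rfl⟩, rfl⟩
  · rintro ⟨_, _, ⟨r, θ, ⟨⟨h0, h1⟩, h2⟩, h⟩, rfl⟩
    obtain ⟨rfl, rfl⟩ := Prod.mk.inj h
    exact ⟨r, θ, h0, h1, h2, rfl⟩

theorem measurePreserving_pair :
    MeasurePreserving (fun p : ℝ × ℝ => (!₂[p.1, p.2] : Plane)) :=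
  (PiLp.volume_preserving_toLp (Fin 2)).comp (volume_preserving_finTwoArrow ℝ).symm

theorem measurableEmbedding_pair :
    MeasurableEmbedding (fun p : ℝ × ℝ => (!₂[p.1, p.2] : Plane)) :=
  (MeasurableEquiv.toLp 2 (Fin 2 → ℝ)).measurableEmbedding.comp
    (MeasurableEquiv.finTwoArrow (α := ℝ)).symm.measurableEmbedding

/-- Change of variables with Jacobian r: the angular interval lies inside (-π, π), where the polar
chart is injective. Working with `lintegral` makes Tonelli available without integrability
conditions. -/
theorem lintegral_sector {α ρ : ℝ} (hαπ : α < Real.pi) {F : Plane → ENNReal}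
    (hF : Measurable F) :
    ∫⁻ x in sector α ρ, F x = ∫⁻ θ in Ioo (-(α / 2)) (α / 2), ∫⁻ r in Ioo 0 ρ,
      ENNReal.ofReal r * F (polarPt r θ) := by
  have hT : Ioo 0 ρ ×ˢ Ioo (-(α / 2)) (α / 2) ⊆ polarCoord.target := by
    rintro ⟨r, θ⟩ ⟨hr, hθ⟩
    simp only [mem_Ioo] at hr hθ
    simp only [polarCoord_target, mem_prod, mem_Ioi, mem_Ioo]
    refine ⟨hr.1, ?_, ?_⟩ <;> linarith [Real.pi_pos]
  have hU : IsOpen (polarCoord.symm '' (Ioo 0 ρ ×ˢ Ioo (-(α / 2)) (α / 2))) :=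
    polarCoord.isOpen_image_symm_of_subset_target (isOpen_Ioo.prod isOpen_Ioo) hT
  set U := polarCoord.symm '' (Ioo 0 ρ ×ˢ Ioo (-(α / 2)) (α / 2)) with hUdef
  have hGm : Measurable fun p : ℝ × ℝ => ENNReal.ofReal p.1 * F (polarPt p.1 p.2) :=
    (ENNReal.measurable_ofReal.comp measurable_fst).mul (hF.comp continuous_polarPt.measurable)
  rw [sector_eq_image, ← measurePreserving_pair.setLIntegral_comp_emb measurableEmbedding_pair,
    ← lintegral_indicator hU.measurableSet, ← lintegral_comp_polarCoord_symm]
  have hind : ∫⁻ p in polarCoord.target, ENNReal.ofReal p.1 •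
      U.indicator (fun a : ℝ × ℝ => F !₂[a.1, a.2]) (polarCoord.symm p)
      = ∫⁻ p in polarCoord.target, (Ioo 0 ρ ×ˢ Ioo (-(α / 2)) (α / 2)).indicator
        (fun p => ENNReal.ofReal p.1 * F (polarPt p.1 p.2)) p := by
    refine setLIntegral_congr_fun polarCoord.open_target.measurableSet fun p hp => ?_
    have hiff : polarCoord.symm p ∈ U ↔ p ∈ Ioo 0 ρ ×ˢ Ioo (-(α / 2)) (α / 2) := by
      constructor
      · rintro ⟨q, hq, hqp⟩
        rwa [← polarCoord.symm.injOn (hT hq) hp hqp]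
      · exact fun h => mem_image_of_mem _ h
    by_cases h : p ∈ Ioo 0 ρ ×ˢ Ioo (-(α / 2)) (α / 2)
    · rw [indicator_of_mem h, indicator_of_mem (hiff.2 h)]
      rfl
    · simp only [indicator_of_notMem h, indicator_of_notMem (mt hiff.1 h), smul_zero]
  rw [hind, setLIntegral_indicator (measurableSet_Ioo.prod measurableSet_Ioo),
    inter_eq_left.2 hT, Measure.volume_eq_prod, ← Measure.prod_restrict,
    lintegral_prod_symm' _ hGm]

/-! ### The Poincaré inequality -/

/-- The one-dimensional Poincaré inequality with weight r, obtained by integrating the derivative of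
r² g². The factor r² removes any boundary term at the corner. -/
theorem integral_mul_sq_le {ρ : ℝ} (hρ : 0 < ρ) {g g' : ℝ → ℝ} (hg : ∀ r, HasDerivAt g (g' r) r)
    (hg' : Continuous g') :
    ∫ r in (0)..ρ, r * g r ^ 2 ≤ ρ ^ 2 * g ρ ^ 2 + ρ ^ 2 * ∫ r in (0)..ρ, r * g' r ^ 2 := by
  have hgc : Continuous g := continuous_iff_continuousAt.2 fun r => (hg r).continuousAt
  have hd : ∀ r, HasDerivAt (fun r => r ^ 2 * g r ^ 2)
      (2 * (r * g r ^ 2) + 2 * (r ^ 2 * (g r * g' r))) r := fun r => by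
    refine (((hasDerivAt_id r).pow 2).mul ((hg r).pow 2)).congr_deriv ?_
    simp
    ring
  have hFTC := intervalIntegral.integral_eq_sub_of_hasDerivAt (a := 0) (b := ρ)
    (fun r _ => hd r) (Continuous.intervalIntegrable (by fun_prop) _ _)
  have hmono : ∫ r in (0)..ρ, (r * g r ^ 2 - ρ ^ 2 * (r * g' r ^ 2))
      ≤ ∫ r in (0)..ρ, (2 * (r * g r ^ 2) + 2 * (r ^ 2 * (g r * g' r))) := by
    refine intervalIntegral.integral_mono_on hρ.le
      (Continuous.intervalIntegrable (by fun_prop) _ _)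
      (Continuous.intervalIntegrable (by fun_prop) _ _) fun r hr => ?_
    -- The square absorbs the mixed term 2 r² g g' at the cost of r³ g'², which is at most ρ² r g'².
    have h1 : 0 ≤ r * (g r + r * g' r) ^ 2 := mul_nonneg hr.1 (sq_nonneg _)
    have h2 : r ^ 2 ≤ ρ ^ 2 := pow_le_pow_left₀ hr.1 hr.2 2
    have h3 : 0 ≤ (ρ ^ 2 - r ^ 2) * (r * g' r ^ 2) :=
      mul_nonneg (sub_nonneg.2 h2) (mul_nonneg hr.1 (sq_nonneg _))
    nlinarith
  rw [intervalIntegral.integral_sub (Continuous.intervalIntegrable (by fun_prop) _ _)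
    (Continuous.intervalIntegrable (by fun_prop) _ _), intervalIntegral.integral_const_mul,
    hFTC] at hmono
  linarith

theorem lintegral_mul_sq_le {ρ : ℝ} (hρ : 0 < ρ) {g g' : ℝ → ℝ}
    (hg : ∀ r, HasDerivAt g (g' r) r) (hg' : Continuous g') :
    ∫⁻ r in Ioo 0 ρ, ENNReal.ofReal r * ‖g r‖ₑ ^ 2 ≤ ENNReal.ofReal (ρ ^ 2) * ‖g ρ‖ₑ ^ 2
      + ENNReal.ofReal (ρ ^ 2) * ∫⁻ r in Ioo 0 ρ, ENNReal.ofReal r * ‖g' r‖ₑ ^ 2 := by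
  have hgc : Continuous g := continuous_iff_continuousAt.2 fun r => (hg r).continuousAt
  have hsq : ∀ t : ℝ, ‖t‖ₑ ^ 2 = ENNReal.ofReal (t ^ 2) := fun t => by
    rw [Real.enorm_eq_ofReal_abs, ← ENNReal.ofReal_pow (abs_nonneg t), sq_abs]
  have hconv : ∀ h : ℝ → ℝ, Continuous h → ∫⁻ r in Ioo 0 ρ, ENNReal.ofReal r * ‖h r‖ₑ ^ 2
      = ENNReal.ofReal (∫ r in (0)..ρ, r * h r ^ 2) := fun h hh => by
    have hint : IntervalIntegrable (fun r => r * h r ^ 2) volume 0 ρ :=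
      Continuous.intervalIntegrable (by fun_prop) _ _
    rw [intervalIntegral.integral_of_le hρ.le, integral_Ioc_eq_integral_Ioo,
      ofReal_integral_eq_lintegral_ofReal]
    · refine setLIntegral_congr_fun measurableSet_Ioo fun r hr => ?_
      simp only [hsq, ENNReal.ofReal_mul hr.1.le]
    · exact ((intervalIntegrable_iff_integrableOn_Ioc_of_le hρ.le).1 hint).mono_set
        Ioo_subset_Ioc_self
    · filter_upwards [ae_restrict_mem measurableSet_Ioo] with r hr
      exact mul_nonneg hr.1.le (sq_nonneg _)
  have hnn : ∀ h : ℝ → ℝ, 0 ≤ ∫ r in (0)..ρ, r * h r ^ 2 := fun h =>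
    intervalIntegral.integral_nonneg hρ.le fun r hr => mul_nonneg hr.1 (sq_nonneg _)
  rw [hconv g hgc, hconv g' hg', hsq, ← ENNReal.ofReal_mul (by positivity),
    ← ENNReal.ofReal_mul (by positivity), ← ENNReal.ofReal_add (by positivity)
      (mul_nonneg (by positivity) (hnn _))]
  exact ENNReal.ofReal_le_ofReal (integral_mul_sq_le hρ hg hg')

theorem norm_polarPt_one (θ : ℝ) : ‖polarPt 1 θ‖ = 1 := by
  rw [EuclideanSpace.norm_eq]
  simp [polarPt, Fin.sum_univ_two]

theorem hasDerivAt_polarPt (r θ : ℝ) : HasDerivAt (fun r => polarPt r θ) (polarPt 1 θ) r := by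
  have h : (fun r => polarPt r θ) = fun r : ℝ => r • polarPt 1 θ := by
    funext r
    ext i
    fin_cases i <;> simp [polarPt]
  rw [h]
  simpa using (hasDerivAt_id r).smul_const (polarPt 1 θ)

theorem lintegral_polarPt_sq_le {ρ : ℝ} (hρ : 0 < ρ) {φ : Plane → ℝ} (hφ : ContDiff ℝ ∞ φ)
    (θ : ℝ) :
    ∫⁻ r in Ioo 0 ρ, ENNReal.ofReal r * ‖φ (polarPt r θ)‖ₑ ^ 2 ≤
      ENNReal.ofReal (ρ ^ 2) * ‖φ (polarPt ρ θ)‖ₑ ^ 2 + ENNReal.ofReal (ρ ^ 2) *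
        ∫⁻ r in Ioo 0 ρ, ENNReal.ofReal r * ‖gradient φ (polarPt r θ)‖ₑ ^ 2 := by
  have hd : ∀ r, HasDerivAt (fun r => φ (polarPt r θ))
      (fderiv ℝ φ (polarPt r θ) (polarPt 1 θ)) r := fun r =>
    (hφ.differentiable (by simp) _).hasFDerivAt.comp_hasDerivAt r (hasDerivAt_polarPt r θ)
  have hc : Continuous fun r => fderiv ℝ φ (polarPt r θ) (polarPt 1 θ) :=
    ((hφ.continuous_fderiv (by simp)).comp
      (continuous_polarPt.comp (.prodMk_left θ))).clm_apply continuous_const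
  refine (lintegral_mul_sq_le hρ hd hc).trans ?_
  gcongr with r
  refine enorm_le_iff_norm_le.2 ((ContinuousLinearMap.le_opNorm _ _).trans_eq ?_)
  rw [norm_polarPt_one, mul_one, gradient, LinearIsometryEquiv.norm_map]

theorem eLpNorm_two_sq {X E : Type*} [MeasurableSpace X] [NormedAddCommGroup E] (f : X → E)
    (μ : Measure X) : eLpNorm f 2 μ ^ 2 = ∫⁻ x, ‖f x‖ₑ ^ 2 ∂μ := by
  have h := eLpNorm_nnreal_pow_eq_lintegral (f := f) (μ := μ) (p := 2) two_ne_zero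
  simpa using h

/-- The ray inequality integrated over the angle. The arc term has to stay: the smooth approximants
of a function vanishing on the arc need not vanish there themselves. -/
theorem eLpNorm_sector_le {α ρ : ℝ} (hαπ : α < Real.pi) (hρ : 0 < ρ) {φ : Plane → ℝ}
    (hφ : ContDiff ℝ ∞ φ) :
    eLpNorm φ 2 (volume.restrict (sector α ρ)) ≤ ENNReal.ofReal ρ *
      (eLpNorm (fun θ => φ (polarPt ρ θ)) 2 (volume.restrict (Ioo (-(α / 2)) (α / 2)))
        + eLpNorm (gradient φ) 2 (volume.restrict (sector α ρ))) := by
  rw [← ENNReal.pow_le_pow_left_iff two_ne_zero, mul_pow]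
  have hgc := continuous_gradient_of_contDiff hφ
  have hm : Measurable fun θ => ENNReal.ofReal (ρ ^ 2) * ‖φ (polarPt ρ θ)‖ₑ ^ 2 :=
    ((hφ.continuous.comp (continuous_polarPt.comp (.prodMk_right ρ))).measurable.enorm.pow_const
      2).const_mul _
  have h : eLpNorm φ 2 (volume.restrict (sector α ρ)) ^ 2 ≤ ENNReal.ofReal (ρ ^ 2) *
      eLpNorm (fun θ => φ (polarPt ρ θ)) 2 (volume.restrict (Ioo (-(α / 2)) (α / 2))) ^ 2
      + ENNReal.ofReal (ρ ^ 2) * eLpNorm (gradient φ) 2 (volume.restrict (sector α ρ)) ^ 2 := by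
    rw [eLpNorm_two_sq, eLpNorm_two_sq, eLpNorm_two_sq,
      lintegral_sector hαπ (hφ.continuous.measurable.enorm.pow_const 2),
      lintegral_sector hαπ (hgc.measurable.enorm.pow_const 2),
      ← lintegral_const_mul' _ _ ENNReal.ofReal_ne_top,
      ← lintegral_const_mul' _ _ ENNReal.ofReal_ne_top, ← lintegral_add_left hm]
    exact lintegral_mono fun θ => lintegral_polarPt_sq_le hρ hφ θ
  refine h.trans ?_
  rw [← mul_add, ENNReal.ofReal_pow hρ.le]
  gcongr
  rw [add_sq]
  gcongr
  exact le_self_add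

theorem VanishesOnArc.norm_h1fn_le {α ρ : ℝ} (hαπ : α < Real.pi) (hρ : 0 < ρ)
    {u : H1 (sector α ρ)} (hu : VanishesOnArc u) : ‖h1fn u‖ ≤ ρ * ‖h1grad u‖ := by
  obtain ⟨-, φ, hφ, h1, h2, h3⟩ := hu
  simp only [Pi.zero_apply, sub_zero] at h3
  set μ := volume.restrict (sector α ρ)
  have hle : eLpNorm (h1fn u) 2 μ ≤ ENNReal.ofReal ρ * eLpNorm (h1grad u) 2 μ := by
    have hlim := h1.add (ENNReal.Tendsto.const_mul (a := ENNReal.ofReal ρ)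
      (h3.add (h2.add (tendsto_const_nhds (x := eLpNorm (h1grad u) 2 μ))))
      (Or.inr ENNReal.ofReal_ne_top))
    simp only [zero_add] at hlim
    refine ge_of_tendsto' hlim fun n => ?_
    have hf : eLpNorm (h1fn u) 2 μ ≤ eLpNorm (fun x => φ n x - h1fn u x) 2 μ
        + eLpNorm (φ n) 2 μ := by
      rw [add_comm]
      refine le_trans (le_of_eq (congrArg (fun F => eLpNorm F 2 _) ?_)) (eLpNorm_sub_le
        (hφ n).continuous.aestronglyMeasurable ((hφ n).continuous.aestronglyMeasurable.sub
          (Lp.aestronglyMeasurable (h1fn u))) (by norm_num))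
      funext x
      simp
    have hgr : eLpNorm (gradient (φ n)) 2 μ ≤
        eLpNorm (fun x => gradient (φ n) x - h1grad u x) 2 μ + eLpNorm (h1grad u) 2 μ := by
      refine le_trans (le_of_eq (congrArg (fun F => eLpNorm F 2 _) ?_)) (eLpNorm_add_le
        ((continuous_gradient_of_contDiff (hφ n)).aestronglyMeasurable.sub
          (Lp.aestronglyMeasurable (h1grad u))) (Lp.aestronglyMeasurable _) (by norm_num))
      funext x
      simp
    refine hf.trans ?_
    gcongr
    refine (eLpNorm_sector_le hαπ hρ (hφ n)).trans ?_
    gcongr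
  rw [Lp.norm_def, Lp.norm_def]
  refine (ENNReal.toReal_mono ?_ hle).trans_eq ?_
  · exact ENNReal.mul_ne_top ENNReal.ofReal_ne_top (Lp.eLpNorm_ne_top _)
  · rw [ENNReal.toReal_mul, ENNReal.toReal_ofReal hρ.le]

/-! ### The polar forms as bounded bilinear forms -/

theorem norm_inner_field_le {e : Plane → Plane} (hb : ∀ x, ‖e x‖ ≤ 1) (G : Plane → Plane)
    (x : Plane) : ‖(inner ℝ (e x) (G x) : ℝ)‖ ≤ ‖G x‖ :=
  (norm_inner_le_norm _ _).trans (mul_le_of_le_one_left (norm_nonneg _) (hb x))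

theorem memLp_inner_field {μ : Measure Plane} {e : Plane → Plane} (he : Measurable e)
    (hb : ∀ x, ‖e x‖ ≤ 1) (G : Lp Plane 2 μ) :
    MemLp (fun x => (inner ℝ (e x) (G x) : ℝ)) 2 μ :=
  (Lp.memLp G).mono (he.aestronglyMeasurable.inner (Lp.aestronglyMeasurable G))
    (Eventually.of_forall (norm_inner_field_le hb G))

/-- Pointwise inner product with a bounded measurable vector field, as an operator on `L²`. -/
noncomputable def innerField (μ : Measure Plane) (e : Plane → Plane) (he : Measurable e)
    (hb : ∀ x, ‖e x‖ ≤ 1) : Lp Plane 2 μ →L[ℝ] Lp ℝ 2 μ :=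
  have hm := memLp_inner_field (μ := μ) he hb
  LinearMap.mkContinuous
    { toFun := fun G => (hm G).toLp _
      map_add' := fun F G => by
        refine Lp.ext ?_
        filter_upwards [(hm (F + G)).coeFn_toLp, (hm F).coeFn_toLp, (hm G).coeFn_toLp,
          Lp.coeFn_add F G, Lp.coeFn_add ((hm F).toLp _) ((hm G).toLp _)] with x h1 h2 h3 h4 h5
        rw [h1, h5, Pi.add_apply, h2, h3, h4, Pi.add_apply, inner_add_right]
      map_smul' := fun c G => by
        refine Lp.ext ?_
        filter_upwards [(hm (c • G)).coeFn_toLp, (hm G).coeFn_toLp,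
          Lp.coeFn_smul c G, Lp.coeFn_smul c ((hm G).toLp _)] with x h1 h2 h3 h4
        rw [h1, RingHom.id_apply, h4, Pi.smul_apply, h2, h3, Pi.smul_apply, inner_smul_right,
          smul_eq_mul] }
    1 fun G => by
      rw [one_mul]
      refine Lp.norm_le_norm_of_ae_le ?_
      filter_upwards [(hm G).coeFn_toLp] with x h1
      exact (congrArg norm h1).trans_le (norm_inner_field_le hb G x)

theorem coeFn_innerField {μ : Measure Plane} {e : Plane → Plane} (he : Measurable e)
    (hb : ∀ x, ‖e x‖ ≤ 1) (G : Lp Plane 2 μ) :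
    innerField μ e he hb G =ᵐ[μ] fun x => inner ℝ (e x) (G x) :=
  MemLp.coeFn_toLp (memLp_inner_field he hb G)

/-- The quarter turn of the plane. -/
noncomputable def rotate (x : Plane) : Plane := !₂[-x 1, x 0]

theorem norm_rotate (x : Plane) : ‖rotate x‖ = ‖x‖ := by
  rw [EuclideanSpace.norm_eq, EuclideanSpace.norm_eq]
  simp [rotate, Fin.sum_univ_two, add_comm]

theorem continuous_rotate : Continuous rotate := by
  unfold rotate
  fun_prop

theorem norm_inv_norm_smul_le (x y : Plane) (h : ‖y‖ = ‖x‖) : ‖‖x‖⁻¹ • y‖ ≤ 1 := by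
  rw [norm_smul, norm_inv, norm_norm, h]
  exact inv_mul_le_one

/-- The radial derivative as an operator on square integrable gradients. -/
noncomputable def radialOp (μ : Measure Plane) : Lp Plane 2 μ →L[ℝ] Lp ℝ 2 μ :=
  innerField μ (fun x => ‖x‖⁻¹ • x) (measurable_norm.inv.smul measurable_id)
    fun x => norm_inv_norm_smul_le x x rfl

/-- The angular derivative as an operator on square integrable gradients. -/
noncomputable def angularOp (μ : Measure Plane) : Lp Plane 2 μ →L[ℝ] Lp ℝ 2 μ :=
  innerField μ (fun x => ‖x‖⁻¹ • rotate x) (measurable_norm.inv.smul continuous_rotate.measurable)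
    fun x => norm_inv_norm_smul_le x _ (norm_rotate x)

theorem coeFn_radialOp {μ : Measure Plane} (G : Lp Plane 2 μ) :
    radialOp μ G =ᵐ[μ] radialPart G := by
  filter_upwards [coeFn_innerField (measurable_norm.inv.smul measurable_id)
    (fun x => norm_inv_norm_smul_le x x rfl) G] with x hx
  refine hx.trans ?_
  simp only [radialPart, PiLp.inner_apply, Fin.sum_univ_two]
  simp
  ring

theorem coeFn_angularOp {μ : Measure Plane} (G : Lp Plane 2 μ) :
    angularOp μ G =ᵐ[μ] angularPart G := by
  filter_upwards [coeFn_innerField (measurable_norm.inv.smul continuous_rotate.measurable)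
    (fun x => norm_inv_norm_smul_le x _ (norm_rotate x)) G] with x hx
  refine hx.trans ?_
  simp only [angularPart, PiLp.inner_apply, Fin.sum_univ_two]
  simp [rotate]
  ring

/-- Away from the origin x/‖x‖ and its quarter turn are an orthonormal frame, so this is Pythagoras.
-/
theorem radialPart_mul_add_angularPart_mul (G : Plane → Plane) {x : Plane} (hx : x ≠ 0) :
    radialPart G x * radialPart G x + angularPart G x * angularPart G x
      = inner ℝ (G x) (G x) := by
  have h0 : ‖x‖ ≠ 0 := norm_ne_zero_iff.2 hx
  have h1 : ‖x‖ ^ 2 = x 0 ^ 2 + x 1 ^ 2 := by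
    rw [EuclideanSpace.real_norm_sq_eq, Fin.sum_univ_two]
  simp only [radialPart, angularPart, PiLp.inner_apply, Fin.sum_univ_two]
  field_simp
  simp only [RCLike.inner_apply, conj_trivial]
  rw [h1]
  ring

/-- The weak gradient as a bounded operator. -/
noncomputable def gradOp (S : Set Plane) : H1 S →L[ℝ] Lp Plane 2 (volume.restrict S) :=
  (WithLp.sndL 2 ℝ _ _).comp (H1 S).subtypeL

/-- The form `polarForm a` as a bounded bilinear form. -/
noncomputable def polarBilin (S : Set Plane) (a : ℝ) : H1 S →L[ℝ] H1 S →L[ℝ] ℝ :=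
  ((innerSL ℝ : Lp ℝ 2 (volume.restrict S) →L[ℝ] Lp ℝ 2 (volume.restrict S) →L[ℝ] ℝ).bilinearComp
    ((radialOp _).comp (gradOp S)) ((radialOp _).comp (gradOp S))) +
  a ^ 2 • ((innerSL ℝ :
    Lp ℝ 2 (volume.restrict S) →L[ℝ] Lp ℝ 2 (volume.restrict S) →L[ℝ] ℝ).bilinearComp
    ((angularOp _).comp (gradOp S)) ((angularOp _).comp (gradOp S)))

theorem polarBilin_eq_inner {S : Set Plane} (a : ℝ) (u φ : H1 S) :
    polarBilin S a u φ = inner ℝ (radialOp _ (h1grad u)) (radialOp _ (h1grad φ))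
      + a ^ 2 * inner ℝ (angularOp _ (h1grad u)) (angularOp _ (h1grad φ)) := rfl

theorem polarBilin_apply {S : Set Plane} (a : ℝ) (u φ : H1 S) :
    polarBilin S a u φ = polarForm a u φ := by
  rw [polarBilin_eq_inner, L2.inner_def, L2.inner_def, ← integral_const_mul,
    ← integral_add (L2.integrable_inner _ _) ((L2.integrable_inner _ _).const_mul _)]
  refine integral_congr_ae ?_
  filter_upwards [coeFn_radialOp (h1grad u), coeFn_radialOp (h1grad φ),
    coeFn_angularOp (h1grad u), coeFn_angularOp (h1grad φ)] with x h1 h2 h3 h4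
  simp only [h1, h2, h3, h4, RCLike.inner_apply, conj_trivial]
  ring

theorem polarBilin_comm {S : Set Plane} (a : ℝ) (u φ : H1 S) :
    polarBilin S a u φ = polarBilin S a φ u := by
  simp only [polarBilin_eq_inner, real_inner_comm]

theorem polarBilin_one_self {S : Set Plane} (u : H1 S) :
    polarBilin S 1 u u = ‖h1grad u‖ ^ 2 := by
  rw [polarBilin_apply, ← real_inner_self_eq_norm_sq, L2.inner_def]
  refine integral_congr_ae ?_
  have h0 : ∀ᵐ x ∂(volume.restrict S : Measure Plane), x ≠ 0 :=
    ae_restrict_of_ae (Measure.ae_ne volume 0)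
  filter_upwards [h0] with x hx
  simp only [one_pow, one_mul, radialPart_mul_add_angularPart_mul _ hx]

theorem polarBilin_self_eq {S : Set Plane} (a : ℝ) (u : H1 S) :
    polarBilin S a u u = ‖radialOp _ (h1grad u)‖ ^ 2 + a ^ 2 * ‖angularOp _ (h1grad u)‖ ^ 2 := by
  rw [polarBilin_eq_inner, real_inner_self_eq_norm_sq, real_inner_self_eq_norm_sq]

theorem polarBilin_self_le {S : Set Plane} {a : ℝ} (ha : 0 ≤ a) (ha1 : a ≤ 1) (u : H1 S) :
    polarBilin S a u u ≤ polarBilin S 1 u u := by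
  rw [polarBilin_self_eq, polarBilin_self_eq]
  have : a ^ 2 ≤ 1 ^ 2 := pow_le_pow_left₀ ha ha1 2
  gcongr

theorem sq_mul_le_polarBilin_self {S : Set Plane} {a : ℝ} (ha : 0 ≤ a) (ha1 : a ≤ 1)
    (u : H1 S) : a ^ 2 * polarBilin S 1 u u ≤ polarBilin S a u u := by
  rw [polarBilin_self_eq, polarBilin_self_eq]
  have h1 : a ^ 2 ≤ 1 := pow_le_one₀ ha ha1
  nlinarith [mul_nonneg (sub_nonneg.2 h1) (sq_nonneg ‖radialOp _ (h1grad u)‖)]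

theorem VanishesOnArc.norm_sq_le {α ρ : ℝ} (hαπ : α < Real.pi) (hρ : 0 < ρ)
    {u : H1 (sector α ρ)} (hu : VanishesOnArc u) :
    ‖u‖ ^ 2 ≤ (1 + ρ ^ 2) * polarBilin _ 1 u u := by
  have h := pow_le_pow_left₀ (norm_nonneg _) (hu.norm_h1fn_le hαπ hρ) 2
  rw [mul_pow] at h
  rw [norm_sq_H1, polarBilin_one_self]
  linarith

/-! ### The transmission problem in Hilbert spaces -/

section Abstract

variable {X Y : Type*} [NormedAddCommGroup X] [InnerProductSpace ℝ X]
  [NormedAddCommGroup Y] [InnerProductSpace ℝ Y]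

/-- The weak transmission problem for forms `b`, `a` on `X`, where `j : Y → X` includes the
functions of zero boundary values. -/
structure IsTransmissionSolution (b a : X →L[ℝ] X →L[ℝ] ℝ) (j : Y →L[ℝ] X) (A k : ℝ)
    (f g : X →L[ℝ] ℝ) (w v : X) : Prop where
  eq_boundary : ∃ d, w = v + j d
  eq_w : ∀ z, b w (j z) = -f (j z)
  eq_v : ∀ z, a v (j z) = -g (j z)
  flux : ∀ χ, A⁻¹ * a v χ + k * b w χ = -(A⁻¹ * g χ) - k * f χ

/-- Symmetric bounded forms with `A² b ≤ a ≤ b`, the form `b` being coercive. -/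
structure IsFormPair (b a : X →L[ℝ] X →L[ℝ] ℝ) (A P : ℝ) : Prop where
  pos : 0 < A
  const_pos : 0 < P
  comm_b : ∀ x y, b x y = b y x
  comm_a : ∀ x y, a x y = a y x
  lower : ∀ x, A ^ 2 * b x x ≤ a x x
  upper : ∀ x, a x x ≤ b x x
  coercive : ∀ x, ‖x‖ ^ 2 ≤ P * b x x

theorem IsFormPair.nonneg {b a : X →L[ℝ] X →L[ℝ] ℝ} {A P : ℝ} (h : IsFormPair b a A P) (x : X) :
    0 ≤ b x x :=
  nonneg_of_mul_nonneg_right ((sq_nonneg _).trans (h.coercive x)) h.const_pos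

theorem IsFormPair.mul_le {b a : X →L[ℝ] X →L[ℝ] ℝ} {A P : ℝ} (h : IsFormPair b a A P) (x : X) :
    A * b x x ≤ A⁻¹ * a x x := by
  rw [inv_mul_eq_div, le_div_iff₀ h.pos]
  linarith [h.lower x]

/-- Reduces coercivity on the product to a lower bound by b in each component; since `j` does not
shrink norms, coercivity of b on X also controls the Y component. -/
theorem isCoercive_of_le {b a : X →L[ℝ] X →L[ℝ] ℝ} {j : Y →L[ℝ] X} {A P m : ℝ}
    (hb : IsFormPair b a A P) (hj : ∀ y, ‖y‖ ≤ ‖j y‖) (hm : 0 < m)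
    {B : WithLp 2 (X × Y) →L[ℝ] WithLp 2 (X × Y) →L[ℝ] ℝ}
    (h : ∀ x, m * (b x.fst x.fst + b (j x.snd) (j x.snd)) ≤ B x x) : IsCoercive B := by
  have hP := hb.const_pos
  refine ⟨m / P, by positivity, fun x => le_trans ?_ (h x)⟩
  rw [mul_assoc, ← sq, div_mul_eq_mul_div, div_le_iff₀ hP, mul_assoc, mul_comm _ P,
    WithLp.prod_norm_sq_eq_of_L2, mul_add P]
  refine mul_le_mul_of_nonneg_left (add_le_add (hb.coercive _) ?_) hm.le
  exact (pow_le_pow_left₀ (norm_nonneg _) (hj _) 2).trans (hb.coercive _)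

/-- Lax–Milgram; the bound comes from testing the equation with its own solution and cancelling one
factor ‖x‖. -/
theorem IsCoercive.existsUnique_bound {V : Type*} [NormedAddCommGroup V] [InnerProductSpace ℝ V]
    [CompleteSpace V] {B : V →L[ℝ] V →L[ℝ] ℝ} (hB : IsCoercive B) :
    ∃ C : ℝ, 0 < C ∧ ∀ L : V →L[ℝ] ℝ, ∃ x, (∀ y, B x y = L y) ∧
      (∀ x', (∀ y, B x' y = L y) → x' = x) ∧ ‖x‖ ≤ C * ‖L‖ := by
  obtain ⟨c, hc, hcB⟩ := id hB
  refine ⟨c⁻¹, inv_pos.2 hc, fun L => ?_⟩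
  let z := (InnerProductSpace.toDual ℝ V).symm L
  have hz : ∀ y, inner ℝ z y = L y := fun y => InnerProductSpace.toDual_symm_apply
  have hx : ∀ y, B (hB.continuousLinearEquivOfBilin.symm z) y = L y := fun y => by
    rw [← hB.continuousLinearEquivOfBilin_apply, ContinuousLinearEquiv.apply_symm_apply, hz]
  refine ⟨_, hx, fun x' hx' => ?_, ?_⟩
  · rw [ContinuousLinearEquiv.eq_symm_apply]
    exact (hB.unique_continuousLinearEquivOfBilin fun y => (hz y).trans (hx' y).symm).symm
  · set x := hB.continuousLinearEquivOfBilin.symm z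
    have h1 : c * ‖x‖ * ‖x‖ ≤ ‖L‖ * ‖x‖ :=
      (hcB x).trans ((le_abs_self _).trans (by rw [hx x]; exact L.le_opNorm x))
    rcases (norm_nonneg x).eq_or_lt with h0 | h0
    · rw [← h0]
      positivity
    · rw [inv_mul_eq_div, le_div_iff₀ hc, mul_comm]
      exact le_of_mul_le_mul_right h1 h0

/-- Unique solvability with a bound, from a coercive form that represents the system. -/
theorem exists_bound_of_isCoercive [CompleteSpace X] [CompleteSpace Y]
    {b a : X →L[ℝ] X →L[ℝ] ℝ} {j : Y →L[ℝ] X} {A k M : ℝ}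
    {B : WithLp 2 (X × Y) →L[ℝ] WithLp 2 (X × Y) →L[ℝ] ℝ} (hB : IsCoercive B)
    (L : (X →L[ℝ] ℝ) → (X →L[ℝ] ℝ) → WithLp 2 (X × Y) →L[ℝ] ℝ)
    (hL : ∀ f g, ‖L f g‖ ≤ M * (‖f‖ + ‖g‖))
    (s t : WithLp 2 (X × Y) →L[ℝ] X)
    (hiff : ∀ f g w v, IsTransmissionSolution b a j A k f g w v ↔
      ∃ x, w = s x ∧ v = t x ∧ ∀ y, B x y = L f g y) :
    ∃ C : ℝ, 0 < C ∧ ∀ f g : X →L[ℝ] ℝ, ∃ w v, IsTransmissionSolution b a j A k f g w v ∧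
      (∀ w' v', IsTransmissionSolution b a j A k f g w' v' → w' = w ∧ v' = v) ∧
      ‖w‖ + ‖v‖ ≤ C * (‖f‖ + ‖g‖) := by
  obtain ⟨C, hC, h⟩ := hB.existsUnique_bound
  -- No sign is assumed for `M`, hence |M|; the added 1 keeps the constant positive when the product
  -- vanishes.
  refine ⟨(‖s‖ + ‖t‖) * (C * |M|) + 1, by positivity, fun f g => ?_⟩
  obtain ⟨x, hx, hu, hb⟩ := h (L f g)
  refine ⟨s x, t x, (hiff f g _ _).2 ⟨x, rfl, rfl, hx⟩, fun w' v' hW' => ?_, ?_⟩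
  · obtain ⟨x', rfl, rfl, hx'⟩ := (hiff f g w' v').1 hW'
    rw [hu x' hx']
    exact ⟨rfl, rfl⟩
  · have hb' : ‖x‖ ≤ C * |M| * (‖f‖ + ‖g‖) := by
      refine hb.trans ?_
      rw [mul_assoc]
      refine mul_le_mul_of_nonneg_left ((hL f g).trans ?_) hC.le
      exact mul_le_mul_of_nonneg_right (le_abs_self M) (by positivity)
    calc ‖s x‖ + ‖t x‖ ≤ ‖s‖ * ‖x‖ + ‖t‖ * ‖x‖ := add_le_add (s.le_opNorm x) (t.le_opNorm x)
      _ = (‖s‖ + ‖t‖) * ‖x‖ := by ring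
      _ ≤ (‖s‖ + ‖t‖) * (C * |M| * (‖f‖ + ‖g‖)) := by gcongr
      _ ≤ ((‖s‖ + ‖t‖) * (C * |M|) + 1) * (‖f‖ + ‖g‖) := by
          linarith [norm_nonneg f, norm_nonneg g]

/-- The functional `(x, y) ↦ p f x + q g x + r f (j y) + s g (j y)`. -/
noncomputable def pairData (j : Y →L[ℝ] X) (p q r s : ℝ) (f g : X →L[ℝ] ℝ) :
    WithLp 2 (X × Y) →L[ℝ] ℝ :=
  (p • f + q • g).comp (WithLp.fstL 2 ℝ X Y)
    + (r • f + s • g).comp (j.comp (WithLp.sndL 2 ℝ X Y))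

theorem pairData_apply (j : Y →L[ℝ] X) (p q r s : ℝ) (f g : X →L[ℝ] ℝ) (y : WithLp 2 (X × Y)) :
    pairData j p q r s f g y
      = p * f y.fst + q * g y.fst + (r * f (j y.snd) + s * g (j y.snd)) := rfl

theorem norm_combination_le (p q : ℝ) (f g : X →L[ℝ] ℝ) :
    ‖p • f + q • g‖ ≤ (|p| + |q|) * (‖f‖ + ‖g‖) := by
  refine (norm_add_le _ _).trans ?_
  rw [norm_smul, norm_smul, Real.norm_eq_abs, Real.norm_eq_abs]
  nlinarith [mul_nonneg (abs_nonneg p) (norm_nonneg g), mul_nonneg (abs_nonneg q) (norm_nonneg f)]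

theorem norm_pairData_le (j : Y →L[ℝ] X) (p q r s : ℝ) (f g : X →L[ℝ] ℝ) :
    ‖pairData j p q r s f g‖ ≤ ((|p| + |q|) * ‖WithLp.fstL 2 ℝ X Y‖
      + (|r| + |s|) * ‖j.comp (WithLp.sndL 2 ℝ X Y)‖) * (‖f‖ + ‖g‖) := by
  refine (norm_add_le ((p • f + q • g).comp (WithLp.fstL 2 ℝ X Y))
    ((r • f + s • g).comp (j.comp (WithLp.sndL 2 ℝ X Y)))).trans ?_
  have h1 := (ContinuousLinearMap.opNorm_comp_le (p • f + q • g) (WithLp.fstL 2 ℝ X Y)).trans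
    (mul_le_mul_of_nonneg_right (norm_combination_le p q f g) (norm_nonneg _))
  have h2 := (ContinuousLinearMap.opNorm_comp_le (r • f + s • g)
    (j.comp (WithLp.sndL 2 ℝ X Y))).trans
    (mul_le_mul_of_nonneg_right (norm_combination_le r s f g) (norm_nonneg _))
  linarith

/-- The form of the system with unknowns `v` and `w - v`. -/
noncomputable def formAbove (b a : X →L[ℝ] X →L[ℝ] ℝ) (j : Y →L[ℝ] X) (A k : ℝ) :
    WithLp 2 (X × Y) →L[ℝ] WithLp 2 (X × Y) →L[ℝ] ℝ :=
  A⁻¹ • a.bilinearComp (WithLp.fstL 2 ℝ X Y) (WithLp.fstL 2 ℝ X Y)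
    + k • b.bilinearComp (WithLp.fstL 2 ℝ X Y + j.comp (WithLp.sndL 2 ℝ X Y))
      (WithLp.fstL 2 ℝ X Y)
    + (k + 2 * A) • b.bilinearComp (WithLp.fstL 2 ℝ X Y + j.comp (WithLp.sndL 2 ℝ X Y))
      (j.comp (WithLp.sndL 2 ℝ X Y))

theorem formAbove_apply (b a : X →L[ℝ] X →L[ℝ] ℝ) (j : Y →L[ℝ] X) (A k : ℝ)
    (x y : WithLp 2 (X × Y)) :
    formAbove b a j A k x y = A⁻¹ * a x.fst y.fst + k * b (x.fst + j x.snd) y.fst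
      + (k + 2 * A) * b (x.fst + j x.snd) (j y.snd) := rfl

/-- The weight k + 2A is chosen to complete a square: after A⁻¹ a(v,v) ≥ A b(v,v), the diagonal is
bounded below by k b(v+d,v+d) + A (b(v,v) + 2 b(v,d) + 2 b(d,d)), which equals (A+k) b(v+d,v+d) + A
b(d,d). -/
theorem isCoercive_formAbove {b a : X →L[ℝ] X →L[ℝ] ℝ} {j : Y →L[ℝ] X} {A P k : ℝ}
    (hb : IsFormPair b a A P) (hj : ∀ y, ‖y‖ ≤ ‖j y‖) (hk : -A < k) :
    IsCoercive (formAbove b a j A k) := by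
  have hA := hb.pos
  have hm : 0 < min (A + k) A := lt_min (by linarith) hA
  refine isCoercive_of_le hb hj (m := min (A + k) A / 3) (by positivity) fun x => ?_
  rw [formAbove_apply]
  generalize x.fst = v
  generalize j x.snd = d
  have h1 := hb.mul_le v
  have hd0 := hb.nonneg d
  have hs0 := hb.nonneg (v + d)
  have hs1 := hb.nonneg (v + d + d)
  have hc := hb.comm_b d v
  have e1 : min (A + k) A * b (v + d) (v + d) ≤ (A + k) * b (v + d) (v + d) :=
    mul_le_mul_of_nonneg_right (min_le_left _ _) hs0
  have e2 : min (A + k) A * b d d ≤ A * b d d :=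
    mul_le_mul_of_nonneg_right (min_le_right _ _) hd0
  -- Since v = (v+d) - d, the parallelogram law gives b(v,v) ≤ 2 b(v+d,v+d) + 2 b(d,d); adding
  -- b(d,d) explains the 3.
  have e3 : min (A + k) A / 3 * (b v v + b d d) ≤
      min (A + k) A * (b (v + d) (v + d) + b d d) := by
    rw [div_mul_eq_mul_div, div_le_iff₀ three_pos, mul_assoc]
    refine mul_le_mul_of_nonneg_left ?_ hm.le
    simp only [map_add, add_apply, hc] at hs0 hs1 ⊢
    linarith [hb.nonneg v]
  simp only [map_add, add_apply, hc] at e1 e3 ⊢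
  linarith

/-- Test pairs (0, z) return the equation for w, because k + 2A ≠ 0, and pairs (χ, 0) return the
flux identity. -/
theorem isTransmissionSolution_iff_formAbove {b a : X →L[ℝ] X →L[ℝ] ℝ} {j : Y →L[ℝ] X}
    {A k : ℝ} (hA : 0 < A) (hk : -A < k) (f g : X →L[ℝ] ℝ) (w v : X) :
    IsTransmissionSolution b a j A k f g w v ↔
      ∃ x, w = (WithLp.fstL 2 ℝ X Y + j.comp (WithLp.sndL 2 ℝ X Y)) x ∧
        v = WithLp.fstL 2 ℝ X Y x ∧ ∀ y, formAbove b a j A k x y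
          = pairData j (-k) (-A⁻¹) (-(k + 2 * A)) 0 f g y := by
  have hM : k + 2 * A ≠ 0 := by linarith
  simp only [formAbove_apply, pairData_apply]
  constructor
  · rintro ⟨⟨d, rfl⟩, h1, -, h3⟩
    refine ⟨WithLp.toLp 2 (v, d), rfl, rfl, fun y => ?_⟩
    rw [WithLp.toLp_fst, WithLp.toLp_snd, h1, h3]
    ring
  · rintro ⟨x, rfl, rfl, h⟩
    have h1 : ∀ z, b (x.fst + j x.snd) (j z) = -f (j z) := fun z => by
      have := h (WithLp.toLp 2 (0, z))
      simp only [WithLp.toLp_fst, WithLp.toLp_snd, map_zero, mul_zero, zero_add, zero_mul,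
        add_zero] at this
      exact mul_left_cancel₀ hM (by linarith)
    have h3 : ∀ χ, A⁻¹ * a x.fst χ + k * b (x.fst + j x.snd) χ
        = -(A⁻¹ * g χ) - k * f χ := fun χ => by
      have := h (WithLp.toLp 2 (χ, 0))
      simp only [WithLp.toLp_fst, WithLp.toLp_snd, map_zero, mul_zero, add_zero] at this
      linarith
    refine ⟨⟨x.snd, rfl⟩, h1, fun z => ?_, h3⟩
    -- The equation for v is the redundant one: it is the flux identity on Y minus k times the
    -- equation for w.
    have e3 := h3 (j z)
    rw [h1 z] at e3
    exact mul_left_cancel₀ (inv_ne_zero hA.ne') (show A⁻¹ * a x.fst (j z) = _ by linarith)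

/-- The form of the system with unknowns `w` and `w - v`. -/
noncomputable def formBelow (b a : X →L[ℝ] X →L[ℝ] ℝ) (j : Y →L[ℝ] X) (A k : ℝ) :
    WithLp 2 (X × Y) →L[ℝ] WithLp 2 (X × Y) →L[ℝ] ℝ :=
  (-k) • b.bilinearComp (WithLp.fstL 2 ℝ X Y) (WithLp.fstL 2 ℝ X Y)
    + (-A⁻¹) • a.bilinearComp (WithLp.fstL 2 ℝ X Y - j.comp (WithLp.sndL 2 ℝ X Y))
      (WithLp.fstL 2 ℝ X Y + j.comp (WithLp.sndL 2 ℝ X Y))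

theorem formBelow_apply (b a : X →L[ℝ] X →L[ℝ] ℝ) (j : Y →L[ℝ] X) (A k : ℝ)
    (x y : WithLp 2 (X × Y)) :
    formBelow b a j A k x y = -k * b x.fst y.fst
      + -A⁻¹ * a (x.fst - j x.snd) (y.fst + j y.snd) := rfl

/-- Testing v = w - d against w + d cancels the cross terms by symmetry of a, leaving -A⁻¹ a(w,w) +
A⁻¹ a(d,d). The upper bound a ≤ b lets -k b(w,w) absorb the negative part. -/
theorem isCoercive_formBelow {b a : X →L[ℝ] X →L[ℝ] ℝ} {j : Y →L[ℝ] X} {A P k : ℝ}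
    (hb : IsFormPair b a A P) (hj : ∀ y, ‖y‖ ≤ ‖j y‖) (hk : k < -A⁻¹) :
    IsCoercive (formBelow b a j A k) := by
  have hA := hb.pos
  have hm : 0 < min (-k - A⁻¹) A := lt_min (by linarith) hA
  refine isCoercive_of_le hb hj hm fun x => ?_
  rw [formBelow_apply]
  generalize x.fst = w
  generalize j x.snd = d
  have h1 := hb.mul_le d
  have h2 : A⁻¹ * a w w ≤ A⁻¹ * b w w :=
    mul_le_mul_of_nonneg_left (hb.upper w) (inv_nonneg.2 hA.le)
  have e1 : min (-k - A⁻¹) A * b w w ≤ (-k - A⁻¹) * b w w :=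
    mul_le_mul_of_nonneg_right (min_le_left _ _) (hb.nonneg w)
  have e2 : min (-k - A⁻¹) A * b d d ≤ A * b d d :=
    mul_le_mul_of_nonneg_right (min_le_right _ _) (hb.nonneg d)
  simp only [map_add, map_sub, sub_apply, hb.comm_a d w]
  linarith

/-- Here the equation for v is the one kept, and that for w is recovered from the flux identity on Y
by dividing by k. -/
theorem isTransmissionSolution_iff_formBelow {b a : X →L[ℝ] X →L[ℝ] ℝ} {j : Y →L[ℝ] X}
    {A k : ℝ} (hA : 0 < A) (hk : k ≠ 0) (f g : X →L[ℝ] ℝ) (w v : X) :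
    IsTransmissionSolution b a j A k f g w v ↔
      ∃ x, w = WithLp.fstL 2 ℝ X Y x ∧
        v = (WithLp.fstL 2 ℝ X Y - j.comp (WithLp.sndL 2 ℝ X Y)) x ∧
        ∀ y, formBelow b a j A k x y = pairData j k A⁻¹ 0 A⁻¹ f g y := by
  simp only [formBelow_apply, pairData_apply]
  constructor
  · rintro ⟨⟨d, rfl⟩, -, h2, h3⟩
    refine ⟨WithLp.toLp 2 (v + j d, d), rfl, (add_sub_cancel_right v (j d)).symm, fun y => ?_⟩
    have e3 := h3 y.fst
    rw [WithLp.toLp_fst, WithLp.toLp_snd, add_sub_cancel_right, map_add (a v), h2]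
    linarith
  · rintro ⟨x, rfl, rfl, h⟩
    have h2 : ∀ z, a (x.fst - j x.snd) (j z) = -g (j z) := fun z => by
      have := h (WithLp.toLp 2 (0, z))
      simp only [WithLp.toLp_fst, WithLp.toLp_snd, map_zero, mul_zero, zero_add, zero_mul] at this
      exact mul_left_cancel₀ (inv_ne_zero hA.ne') (by linarith)
    have h3 : ∀ χ, A⁻¹ * a (x.fst - j x.snd) χ + k * b x.fst χ
        = -(A⁻¹ * g χ) - k * f χ := fun χ => by
      have := h (WithLp.toLp 2 (χ, 0))
      simp only [WithLp.toLp_fst, WithLp.toLp_snd, map_zero, mul_zero, add_zero] at this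
      linarith
    refine ⟨⟨x.snd, (sub_add_cancel _ _).symm⟩, fun z => ?_, h2, h3⟩
    have e3 := h3 (j z)
    rw [h2 z] at e3
    exact mul_left_cancel₀ hk (show k * b x.fst (j z) = _ by linarith)

/-- The transmission problem is well posed for contrasts outside `[-A⁻¹, -A]`. -/
theorem IsFormPair.exists_bound [CompleteSpace X] {b a : X →L[ℝ] X →L[ℝ] ℝ} {A P k : ℝ}
    (hb : IsFormPair b a A P) {Z : Submodule ℝ X} (hZ : IsClosed (Z : Set X))
    (hk : k ∉ Icc (-A⁻¹) (-A)) :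
    ∃ C : ℝ, 0 < C ∧ ∀ f g : X →L[ℝ] ℝ, ∃ w v,
      IsTransmissionSolution b a Z.subtypeL A k f g w v ∧
      (∀ w' v', IsTransmissionSolution b a Z.subtypeL A k f g w' v' → w' = w ∧ v' = v) ∧
      ‖w‖ + ‖v‖ ≤ C * (‖f‖ + ‖g‖) := by
  have hA := hb.pos
  have : CompleteSpace Z := hZ.completeSpace_coe
  have hj : ∀ y : Z, ‖y‖ ≤ ‖Z.subtypeL y‖ := fun _ => le_rfl
  rw [mem_Icc, not_and_or, not_le, not_le] at hk
  rcases hk with hk | hk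
  · have hk0 : k ≠ 0 := (hk.trans (neg_neg_of_pos (inv_pos.2 hA))).ne
    exact exists_bound_of_isCoercive (isCoercive_formBelow hb hj hk)
      (pairData Z.subtypeL k A⁻¹ 0 A⁻¹) (norm_pairData_le _ _ _ _ _) _ _
      (isTransmissionSolution_iff_formBelow hA hk0)
  · exact exists_bound_of_isCoercive (isCoercive_formAbove hb hj hk)
      (pairData Z.subtypeL (-k) (-A⁻¹) (-(k + 2 * A)) 0) (norm_pairData_le _ _ _ _ _) _ _
      (isTransmissionSolution_iff_formAbove hA hk)

end Abstract

section Folded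

set_option maxSynthPendingDepth 3

/-! ### Well-posedness of the folded system -/

/-- The form `polarForm a` on the space of functions vanishing on the arc. -/
noncomputable def arcForm (α ρ a : ℝ) : H1Arc α ρ →L[ℝ] H1Arc α ρ →L[ℝ] ℝ :=
  (polarBilin (sector α ρ) a).bilinearComp (H1Arc α ρ).subtypeL (H1Arc α ρ).subtypeL

theorem arcForm_apply {α ρ : ℝ} (a : ℝ) (u φ : H1Arc α ρ) :
    arcForm α ρ a u φ = polarForm a (u : H1 (sector α ρ)) (φ : H1 (sector α ρ)) :=
  polarBilin_apply a _ _

theorem isFormPair_arcForm {α ρ a : ℝ} (hαπ : α < Real.pi) (hρ : 0 < ρ) (ha : 0 < a)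
    (ha1 : a ≤ 1) : IsFormPair (arcForm α ρ 1) (arcForm α ρ a) a (1 + ρ ^ 2) where
  pos := ha
  const_pos := by positivity
  comm_b u φ := polarBilin_comm 1 (u : H1 (sector α ρ)) φ
  comm_a u φ := polarBilin_comm a (u : H1 (sector α ρ)) φ
  lower u := sq_mul_le_polarBilin_self ha.le ha1 (u : H1 (sector α ρ))
  upper u := polarBilin_self_le ha.le ha1 (u : H1 (sector α ρ))
  coercive u := VanishesOnArc.norm_sq_le hαπ hρ u.2

/-- Multiplying the edge condition by A makes its two sides -k and A⁻¹ multiples of the Green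
functionals. -/
theorem flux_balance_iff {A : ℝ} (hA : 0 < A) (k s t : ℝ) {p p' q q' : ℝ} (hp : p' = p)
    (hq : q' = q) : (s + p) / A ^ 2 = -(k / A) * ((t + q) / 1 ^ 2) ↔
      A⁻¹ * p' + k * q' = -(A⁻¹ * s) - k * t := by
  subst hp hq
  field_simp
  constructor <;> intro h <;> linarith

theorem edgeFlux_eq_iff {α ρ k A : ℝ} (hA : 0 < A) (f g : HNeg1 α ρ) (w v χ : H1Arc α ρ) :
    edgeFlux A (v : H1 (sector α ρ)) g χ = -(k / A) * edgeFlux 1 (w : H1 (sector α ρ)) f χ ↔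
      A⁻¹ * arcForm α ρ A v χ + k * arcForm α ρ 1 w χ = -(A⁻¹ * g χ) - k * f χ :=
  flux_balance_iff hA k (g χ) (f χ) (arcForm_apply A v χ) (arcForm_apply 1 w χ)

theorem mem_V1_iff {α ρ : ℝ} (w v : H1Arc α ρ) :
    ((w : H1 (sector α ρ)), (v : H1 (sector α ρ))) ∈ V1 α ρ ↔
      ∃ d, w = v + (H1Zero α ρ).subtypeL d := by
  constructor
  · rintro ⟨-, -, h⟩
    refine ⟨-⟨v - w, h⟩, ?_⟩
    simp
  · rintro ⟨d, rfl⟩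
    refine ⟨(v + (H1Zero α ρ).subtypeL d).2, v.2, ?_⟩
    have h : VanishesOnEdges (((-d : H1Zero α ρ) : H1Arc α ρ) : H1 (sector α ρ)) := (-d).2
    simpa using h

theorem solvesPolar_iff {α ρ : ℝ} (a : ℝ) (u : H1Arc α ρ) (l : HNeg1 α ρ) :
    SolvesPolar a (u : H1 (sector α ρ)) l ↔
      ∀ z, arcForm α ρ a u ((H1Zero α ρ).subtypeL z) = -l ((H1Zero α ρ).subtypeL z) := by
  constructor
  · intro h z
    have h1 := h _ z.2
    have h2 := arcForm_apply a u ((H1Zero α ρ).subtypeL z)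
    exact h2.trans (neg_eq_iff_eq_neg.1 h1)
  · intro h φ hφ
    have h1 := h ⟨φ, hφ⟩
    have h2 := arcForm_apply a u φ
    exact neg_eq_iff_eq_neg.2 (h2.symm.trans h1)

theorem isFoldedSolution_iff {α ρ k : ℝ} (hA : 0 < foldRatio α) (f g : HNeg1 α ρ)
    (w v : H1Arc α ρ) :
    IsFoldedSolution α ρ k f g (w, v) ↔ IsTransmissionSolution (arcForm α ρ 1)
      (arcForm α ρ (foldRatio α)) (H1Zero α ρ).subtypeL (foldRatio α) k f g w v := by
  constructor
  · intro h
    exact ⟨(mem_V1_iff w v).1 h.mem_V1, (solvesPolar_iff 1 w f).1 h.eq_w,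
      (solvesPolar_iff _ v g).1 h.eq_v, fun χ => (edgeFlux_eq_iff hA f g w v χ).1 (h.flux χ)⟩
  · intro h
    exact ⟨(mem_V1_iff w v).2 h.eq_boundary, (solvesPolar_iff 1 w f).2 h.eq_w,
      (solvesPolar_iff _ v g).2 h.eq_v, fun χ => (edgeFlux_eq_iff hA f g w v χ).2 (h.flux χ)⟩

theorem exists_unique_isFoldedSolution {α ρ k : ℝ} (hα : 0 < α) (hαπ : α < Real.pi)
    (hρ : 0 < ρ) (hk : k ∉ Icc (kPlus α) (kMinus α)) :
      ∃ C : ℝ, 0 < C ∧ ∀ f g : HNeg1 α ρ,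
        ∃ W : H1 (sector α ρ) × H1 (sector α ρ),
          IsFoldedSolution α ρ k f g W ∧
          (∀ W' : H1 (sector α ρ) × H1 (sector α ρ), IsFoldedSolution α ρ k f g W' → W' = W) ∧
          ‖h1grad W.1‖ + ‖h1grad W.2‖ ≤ C * (‖f‖ + ‖g‖) := by
  have hA : 0 < foldRatio α := div_pos hα (by linarith)
  have hA1 : foldRatio α ≤ 1 := (div_le_one (by linarith)).2 (by linarith)
  have hkm : kMinus α = -foldRatio α := neg_div _ _
  have hkp : kPlus α = -(foldRatio α)⁻¹ := by rw [kPlus, neg_div, foldRatio, inv_div]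
  rw [hkm, hkp] at hk
  obtain ⟨C, hC, h⟩ := (isFormPair_arcForm hαπ hρ hA hA1).exists_bound (isClosed_H1Zero α ρ) hk
  refine ⟨C, hC, fun f g => ?_⟩
  obtain ⟨w, v, hwv, hu, hb⟩ := h f g
  refine ⟨(w, v), (isFoldedSolution_iff hA f g w v).2 hwv, ?_, ?_⟩
  · rintro ⟨w', v'⟩ hW'
    obtain ⟨hw, hv⟩ := hu ⟨w', hW'.mem_V1.1⟩ ⟨v', hW'.mem_V1.2.1⟩
      ((isFoldedSolution_iff hA f g _ _).1 hW')
    exact Prod.ext (congrArg Subtype.val hw) (congrArg Subtype.val hv)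
  · exact (add_le_add (norm_h1grad_le _) (norm_h1grad_le _)).trans hb

end Folded

theorem mainTheorem3 (α ρ k : ℝ) (hα : 0 < α) (hαπ : α < Real.pi) (hρ : 0 < ρ) :
    (k ≠ 1 → (k ∉ Set.Icc (kPlus α) (kMinus α) ↔
      (k + 1) / (2 * (k - 1)) ∉ Set.Icc (lamMinus α) (lamPlus α))) ∧
    (k ∉ Set.Icc (kPlus α) (kMinus α) →
      ∃ C : ℝ, 0 < C ∧ ∀ f g : HNeg1 α ρ,
        ∃ W : H1 (sector α ρ) × H1 (sector α ρ),
          IsFoldedSolution α ρ k f g W ∧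
          (∀ W' : H1 (sector α ρ) × H1 (sector α ρ), IsFoldedSolution α ρ k f g W' → W' = W) ∧
          ‖h1grad W.1‖ + ‖h1grad W.2‖ ≤ C * (‖f‖ + ‖g‖)) :=
  ⟨notMem_Icc_kPlus_kMinus_iff hα hαπ, exists_unique_isFoldedSolution hα hαπ hρ⟩
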